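/- Let $p,n\ge 1$ be integers, $\sigma>0$, and let $\Lambda=(\mathbb Z/p\mathbb Z)^2$ be the torus. Let $\Theta$ be the space of real $p\times p$ matrices $\theta$ (indexed by $\Lambda$) with $\theta[0,0]=0$ and $\theta[i,j]=\theta[-i,-j]$, and let $\Theta^{\rm iso}$ be the subspace of those with moreover $\theta[i,j]=\theta[-i,j]=\theta[j,i]$. Let $\|\theta\|_1=\sum_{(i,j)\in\Lambda}|\theta[i,j]|$ and let $C(\theta)$ be the $p^2\times p^2$ block circulant matrix with entries $C(\theta)[u,v]=\theta[v-u]$, $u,v\in\Lambda$. When $I-C(\theta)$ is positive definite, $\mathbb E_\theta$ denotes expectation when one observes $n$ independent copies of the centred Gaussian field on $\Lambda$ with covariance matrix $\Sigma_\theta=\sigma^2(I-C(\theta))^{-1}$, and the loss is $$l(\theta_1,\theta)=\frac1{p^2}\operatorname{tr}\big[(C(\theta_1)-C(\theta))\,\Sigma_\theta\,(C(\theta_1)-C(\theta))\big].$$ The collection $\mathcal M_1$ consists of the sets $m=\{u\in\Lambda\setminus\{(0,0)\}:|u|\le\rho\}$, $\rho\in\mathbb R$, where $|u|$ is the Euclidean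 distance on the torus from $u$ to $(0,0)$. For $m\in\mathcal M_1$ let $\Theta_m$ and $\Theta_m^{\rm iso}$ be the spaces of matrices in $\Theta$, resp. $\Theta^{\rm iso}$, that vanish outside $m$, and let $d_m$, $d_m^{\rm iso}$ be their dimensions. Let $\Psi_{i,j}$ be the matrix with entries $1$ at $\pm(i,j)$ and $0$ elsewhere, and $\Psi^{\rm iso}_{i,j}$ the matrix with entries $1$ at the nodes $(\pm i,\pm j),(\pm j,\pm i)$ and $0$ elsewhere. For $r>0$, let $\mathcal C_m(\theta',r)$ be the set of matrices $\theta'+r\sum_{\Psi}\phi_\Psi\Psi$ with $\phi_\Psi\in\{0,1\}$, where $\Psi$ runs over the $d_m$ distinct matrices $\Psi_{i,j}$, $(i,j)\in m$; let $\mathcal C^{\rm iso}_m(\theta',r)$ be defined in the same way from the $d_m^{\rm iso}$ distinct matrices $\Psi^{\rm iso}_{i,j}$, $(i,j)\in m$. Let $\mathrm{Co}$ denote the convex hull. There is a universal constant $L>0$ such that for all $p,n,\sigma$ as above and all $m\in\mathcal M_1$: 1. If $\theta'\in\Theta_m$, $\|\theta'\|_1<1$, $r>0$ and $1-\|\theta'\|_1-2rd_m>0$,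 then for every estimator $\widehat\theta$ (a measurable function of the observations with values in $\Theta$) $$\sup_{\theta\in\mathrm{Co}[\mathcal C_m(\theta',r)]}\mathbb E_\theta\big[l(\widehat\theta,\theta)\big]\ \ge\ L\left(r^2\wedge\frac{(1-\|\theta'\|_1)^2}{np^2}\right)d_m\,\sigma^2 .$$ 2. If $\theta'\in\Theta_m^{\rm iso}$, $\|\theta'\|_1<1$, $r>0$ and $1-\|\theta'\|_1-8rd_m^{\rm iso}>0$, then for every estimator $\widehat\theta$ as above $$\sup_{\theta\in\mathrm{Co}[\mathcal C^{\rm iso}_m(\theta',r)]}\mathbb E_\theta\big[l(\widehat\theta,\theta)\big]\ \ge\ L\left(r^2\wedge\frac{(1-\|\theta'\|_1)^2}{np^2}\right)d_m^{\rm iso}\,\sigma^2 .$$ -/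

import Mathlib

open MeasureTheory ProbabilityTheory
open scoped ENNReal

noncomputable section

namespace GMRF

/-- The toroidal lattice of size `p × p`. -/
abbrev Torus (p : ℕ) : Type := ZMod p × ZMod p

/-- Real `p × p` matrices, with indices taken modulo `p`. -/
abbrev TMat (p : ℕ) : Type := Matrix (ZMod p) (ZMod p) ℝ

/-- The space `Θ` of `p × p` matrices with `θ[0,0] = 0` and `θ[i,j] = θ[-i,-j]`. -/
def Theta (p : ℕ) : Submodule ℝ (TMat p) where
  carrier := {θ | θ 0 0 = 0 ∧ ∀ i j, θ i j = θ (-i) (-j)}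
  add_mem' := by
    rintro a b ⟨ha, ha'⟩ ⟨hb, hb'⟩
    exact ⟨by simp [ha, hb], fun i j => by rw [Matrix.add_apply, Matrix.add_apply, ha', hb']⟩
  zero_mem' := by simp
  smul_mem' := by
    rintro c a ⟨ha, ha'⟩
    exact ⟨by simp [ha], fun i j => by rw [Matrix.smul_apply, Matrix.smul_apply, ha']⟩

/-- The space `Θ^iso` of the matrices of `Θ` such that moreover `θ[i,j] = θ[-i,j] = θ[j,i]`. -/
def ThetaIso (p : ℕ) : Submodule ℝ (TMat p) where
  carrier := {θ | θ ∈ Theta p ∧ ∀ i j, θ i j = θ (-i) j ∧ θ i j = θ j i}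
  add_mem' := by
    rintro a b ⟨ha, ha'⟩ ⟨hb, hb'⟩
    refine ⟨add_mem ha hb, fun i j => ⟨?_, ?_⟩⟩
    · rw [Matrix.add_apply, Matrix.add_apply, (ha' i j).1, (hb' i j).1]
    · rw [Matrix.add_apply, Matrix.add_apply, (ha' i j).2, (hb' i j).2]
  zero_mem' := ⟨zero_mem _, by simp⟩
  smul_mem' := by
    rintro c a ⟨ha, ha'⟩
    refine ⟨Submodule.smul_mem _ c ha, fun i j => ⟨?_, ?_⟩⟩
    · rw [Matrix.smul_apply, Matrix.smul_apply, (ha' i j).1]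
    · rw [Matrix.smul_apply, Matrix.smul_apply, (ha' i j).2]

/-- The matrices whose support lies in the set of nodes `m`. -/
def supportedOn {p : ℕ} (m : Set (Torus p)) : Submodule ℝ (TMat p) where
  carrier := {θ | ∀ i j, (i, j) ∉ m → θ i j = 0}
  add_mem' := by
    intro a b ha hb i j h
    rw [Matrix.add_apply, ha i j h, hb i j h, add_zero]
  zero_mem' := by simp
  smul_mem' := by
    intro c a ha i j h
    rw [Matrix.smul_apply, ha i j h, smul_zero]

/-- `Θ_m`: the matrices of `Θ` supported on `m`. -/
def ThetaM {p : ℕ} (m : Set (Torus p)) : Submodule ℝ (TMat p) := Theta p ⊓ supportedOn m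

/-- `Θ_m^iso`: the matrices of `Θ^iso` supported on `m`. -/
def ThetaMIso {p : ℕ} (m : Set (Torus p)) : Submodule ℝ (TMat p) := ThetaIso p ⊓ supportedOn m

/-- The dimension `d_m` of `Θ_m`. -/
def dimM {p : ℕ} (m : Set (Torus p)) : ℕ := Module.finrank ℝ (ThetaM m)

/-- The dimension `d_m^iso` of `Θ_m^iso`. -/
def dimMIso {p : ℕ} (m : Set (Torus p)) : ℕ := Module.finrank ℝ (ThetaMIso m)

/-- The Euclidean distance, on the torus, from the node `u` to the origin: `valMinAbs` is the
representative of least absolute value of a class modulo `p`. -/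
def torusNorm {p : ℕ} (u : Torus p) : ℝ :=
  Real.sqrt ((u.1.valMinAbs : ℝ) ^ 2 + (u.2.valMinAbs : ℝ) ^ 2)

/-- The collection `ℳ₁` of models: a model is the set of all nodes other than the origin that lie
in some disc centred at the origin. -/
def modelsM1 (p : ℕ) : Set (Set (Torus p)) :=
  {m | ∃ ρ : ℝ, m = {u | u ≠ 0 ∧ torusNorm u ≤ ρ}}

/-- The matrix `Ψ_u`: ones at `u` and `-u`, zeros elsewhere. -/
def psi {p : ℕ} (u : Torus p) : TMat p :=
  Matrix.of fun s t => if (s, t) = u ∨ (s, t) = -u then 1 else 0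

/-- The matrix `Ψ_u^iso`: ones on the orbit of `u = (i,j)`, i.e. at the nodes `(±i,±j)` and
`(±j,±i)`, zeros elsewhere. -/
def psiIso {p : ℕ} (u : Torus p) : TMat p :=
  Matrix.of fun s t =>
    if ((s = u.1 ∨ s = -u.1) ∧ (t = u.2 ∨ t = -u.2)) ∨
      ((s = u.2 ∨ s = -u.2) ∧ (t = u.1 ∨ t = -u.1)) then 1 else 0

/-- The vertices `θ' + r ∑ φ_Ψ Ψ`, with coefficients `φ_Ψ ∈ {0,1}` and `Ψ` running through the
finite set of matrices `B`; here `T = {Ψ | φ_Ψ = 1}`. -/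
def cubeOver {p : ℕ} (B : Set (TMat p)) (θ' : TMat p) (r : ℝ) : Set (TMat p) :=
  {θ | ∃ T : Finset (TMat p), (T : Set (TMat p)) ⊆ B ∧ θ = θ' + r • ∑ Ψ ∈ T, Ψ}

/-- The hypercube `𝒞_m(θ', r)`. The distinct matrices among the `Ψ_u`, `u ∈ m`, are one for each
pair `{u, -u}` of nodes of `m`. -/
def hypercube {p : ℕ} (m : Set (Torus p)) (θ' : TMat p) (r : ℝ) : Set (TMat p) :=
  cubeOver (psi '' m) θ' r

/-- The isotropic hypercube `𝒞_m^iso(θ', r)`. -/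
def hypercubeIso {p : ℕ} (m : Set (Torus p)) (θ' : TMat p) (r : ℝ) : Set (TMat p) :=
  cubeOver (psiIso '' m) θ' r

/-- The block circulant `p² × p²` matrix `C(θ)`. -/
def blockCirc {p : ℕ} (θ : TMat p) : Matrix (Torus p) (Torus p) ℝ :=
  Matrix.of fun u v => θ (v.1 - u.1) (v.2 - u.2)

section

variable {p : ℕ} [NeZero p]

/-- The `ℓ¹` norm of the entries of a matrix. -/
def l1Norm (θ : TMat p) : ℝ := ∑ i, ∑ j, |θ i j|

/-- The covariance matrix `σ² (I - C(θ))⁻¹` of the field. -/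
def fieldCov (σ : ℝ) (θ : TMat p) : Matrix (Torus p) (Torus p) ℝ :=
  σ ^ 2 • (1 - blockCirc θ)⁻¹

/-- The law of `n` independent copies of the centred Gaussian field on the torus whose covariance
matrix is `σ² (I - C(θ))⁻¹`. -/
def sampleLaw (n : ℕ) (σ : ℝ) (θ : TMat p) :
    Measure (Fin n → EuclideanSpace ℝ (Torus p)) :=
  Measure.pi fun _ => multivariateGaussian 0 (fieldCov σ θ)

/-- The loss `l(θ₁, θ) = p⁻² tr[(C(θ₁) - C(θ)) Σ (C(θ₁) - C(θ))]`, where `Σ = σ² (I - C(θ))⁻¹`. -/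
def loss (σ : ℝ) (θ₁ θ : TMat p) : ℝ :=
  ((blockCirc θ₁ - blockCirc θ) * fieldCov σ θ * (blockCirc θ₁ - blockCirc θ)).trace /
    (p : ℝ) ^ 2

/-- An estimator: a measurable function of the `n` observed fields with values in `Θ`. -/
def IsEstimator {n : ℕ} (est : (Fin n → EuclideanSpace ℝ (Torus p)) → TMat p) : Prop :=
  (∀ x, est x ∈ Theta p) ∧ ∀ i j, Measurable fun x => est x i j

/-- The risk `𝔼_θ[l(est, θ)]`, as an element of `[0, ∞]`. -/
def risk {n : ℕ} (σ : ℝ) (est : (Fin n → EuclideanSpace ℝ (Torus p)) → TMat p)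
    (θ : TMat p) : ℝ≥0∞ :=
  ∫⁻ x, ENNReal.ofReal (loss σ (est x) θ) ∂(sampleLaw n σ θ)

end

end GMRF

end

/-!
The bound is an instance of Assouad's lemma. The loss dominates a squared `ℓ²` distance: when
`‖θ‖₁ < 1` the spectrum of `I - C(θ)` lies in `(0, 2)`, so `Σ_θ ≥ σ² / 2`, and every entry of `θ`
occurs `p²` times in `C(θ)`; hence `l(θ₁, θ) ≥ (σ² / 2) ∑ (θ₁[u] - θ[u])²` (`le_loss`). The
matrices `Ψ` spanning the cube are indicators of disjoint sets of nodes, so the coordinates at one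
node of each set separate the `Ψ`, and the risk is at least a sum over `Ψ` of the risks of
estimating one number that takes two values along the edges of the cube in direction `Ψ`.

The side of the cube is shrunk from `r` to `s = min(r, x) / 8`, with
`x = (1 - ‖θ'‖₁) / (√n p)`. The smaller cube stays in the convex hull of the original one, all its
vertices satisfy `1 - ‖θ‖₁ ≥ (1 - ‖θ'‖₁) / 2`, and the laws of the sample at two neighbouring
vertices cannot be told apart reliably. The last point rests on the second moment of the
likelihood ratio `dQ/dP`: if it is at most `2`, then `min(1, dQ/dP) ≥ dQ/dP - (dQ/dP)² / 4` has
integral at least `1 / 2`, so the squared errors in estimating two values `a` and `b` under `P` and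
`Q` add up to at least `(a - b)² / 4` (`LRSecondMomentLE.two_point`).
To bound that moment for two Gaussian laws
`N(0, S₀)` and `N(0, S₁)`, both are written as images, under one linear map, of products of
one-dimensional Gaussian laws of variances `1` and `vᵢ` (`exists_simultaneous_diagonalization`); it
is then a product of one-dimensional factors, at most `exp (n ∑ (1 - vᵢ)²)`, where
`∑ (1 - vᵢ)² = tr ((S₀⁻¹ S₁ - I)²)` is controlled by the Frobenius norm of `C(θ₁) - C(θ₀)`
(`trace_fieldCov_sub_one_sq_le`). `minimax_cubeOver` puts this together for any family of matrices
`Ψ` with the required properties.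

The two cases of the statement differ only in the equivalence relation on the torus whose classes
carry the matrices `Ψ`: the orbits of `u ↦ -u`, of size at most `2`, or those of the symmetry group
of the square, of size at most `8`. The models of `ℳ₁` are unions of such classes, and the
indicators of the classes form a basis of the space of matrices (`finrank_eq_card_classInd`).
-/

namespace GMRF

/-! ### Second moments of likelihood ratios -/

section SecondMoment

/-- `Q` has a density with respect to `P` whose second moment under `P` is at most `K`, i.e. the
`χ²` divergence of `Q` from `P` is at most `K - 1`. -/
def LRSecondMomentLE {α : Type*} [MeasurableSpace α] (P Q : Measure α) (K : ℝ≥0∞) : Prop :=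
  ∃ ℓ : α → ℝ≥0∞, Measurable ℓ ∧ Q = P.withDensity ℓ ∧ ∫⁻ x, ℓ x ^ 2 ∂P ≤ K

theorem LRSecondMomentLE.mono {α : Type*} [MeasurableSpace α] {P Q : Measure α} {K K' : ℝ≥0∞}
    (h : LRSecondMomentLE P Q K) (hK : K ≤ K') : LRSecondMomentLE P Q K' := by
  obtain ⟨ℓ, h1, h2, h3⟩ := h
  exact ⟨ℓ, h1, h2, h3.trans hK⟩

theorem lintegral_pi_prod {ι : Type*} [Fintype ι] {α : ι → Type*} [∀ i, MeasurableSpace (α i)]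
    (P : ∀ i, Measure (α i)) [∀ i, IsProbabilityMeasure (P i)] (f : ∀ i, α i → ℝ≥0∞)
    (hf : ∀ i, Measurable (f i)) :
    ∫⁻ x, ∏ i, f i (x i) ∂(Measure.pi P) = ∏ i, ∫⁻ x, f i x ∂(P i) := by
  rw [lintegral_prod_eq_prod_lintegral_of_indepFun Finset.univ
    (fun i (x : ∀ i, α i) => f i (x i)) (iIndepFun_pi fun i => (hf i).aemeasurable)
    fun i => (hf i).comp (measurable_pi_apply i)]
  refine Finset.prod_congr rfl fun i _ => ?_
  exact (measurePreserving_eval P i).lintegral_comp (hf i)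

/-- The second moment of the likelihood ratio is multiplicative over product measures. -/
theorem LRSecondMomentLE.pi {ι : Type*} [Fintype ι] {α : ι → Type*} [∀ i, MeasurableSpace (α i)]
    {P Q : ∀ i, Measure (α i)} [∀ i, IsProbabilityMeasure (P i)]
    [∀ i, IsProbabilityMeasure (Q i)] {K : ι → ℝ≥0∞} (h : ∀ i, LRSecondMomentLE (P i) (Q i) (K i)) :
    LRSecondMomentLE (Measure.pi P) (Measure.pi Q) (∏ i, K i) := by
  choose ℓ hm hd hK using h
  refine ⟨fun x => ∏ i, ℓ i (x i), ?_, ?_, ?_⟩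
  · exact Finset.measurable_fun_prod _ fun i _ => (hm i).comp (measurable_pi_apply i)
  · refine Measure.pi_eq fun s hs => ?_
    rw [withDensity_apply _ (MeasurableSet.univ_pi hs),
      ← lintegral_indicator (MeasurableSet.univ_pi hs)]
    have : ∀ x : ∀ i, α i, (Set.univ.pi s).indicator (fun x => ∏ i, ℓ i (x i)) x
        = ∏ i, (s i).indicator (ℓ i) (x i) := by
      intro x
      by_cases hx : x ∈ Set.univ.pi s
      · rw [Set.indicator_of_mem hx]
        exact Finset.prod_congr rfl fun i _ => (Set.indicator_of_mem (hx i (Set.mem_univ i)) _).symm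
      · rw [Set.indicator_of_notMem hx]
        simp only [Set.mem_pi, Set.mem_univ, true_implies, not_forall] at hx
        obtain ⟨i, hi⟩ := hx
        exact (Finset.prod_eq_zero (Finset.mem_univ i) (Set.indicator_of_notMem hi _)).symm
    simp_rw [this]
    rw [lintegral_pi_prod P _ fun i => (hm i).indicator (hs i)]
    refine Finset.prod_congr rfl fun i _ => ?_
    rw [lintegral_indicator (hs i), hd i, withDensity_apply _ (hs i)]
  · simp_rw [← Finset.prod_pow]
    rw [lintegral_pi_prod P (fun i y => ℓ i y ^ 2) fun i => (hm i).pow_const 2]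
    exact Finset.prod_le_prod' fun i _ => hK i

/-- Two-point bound: when the second moment of the likelihood ratio is at most `2`, no function
of the data is close to `a` under `P` and to `b` under `Q`. -/
theorem LRSecondMomentLE.two_point {α : Type*} [MeasurableSpace α] {P Q : Measure α}
    [IsProbabilityMeasure P] [IsProbabilityMeasure Q] (h : LRSecondMomentLE P Q 2)
    {f : α → ℝ} (hf : Measurable f) (a b : ℝ) :
    ENNReal.ofReal ((a - b) ^ 2 / 4) ≤
      ∫⁻ x, ENNReal.ofReal ((f x - a) ^ 2) ∂P + ∫⁻ x, ENNReal.ofReal ((f x - b) ^ 2) ∂Q := by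
  obtain ⟨ℓ, hm, hd, hK⟩ := h
  have hone : ∫⁻ x, ℓ x ∂P = 1 := by
    have := measure_univ (μ := Q)
    rwa [hd, withDensity_apply _ MeasurableSet.univ, Measure.restrict_univ] at this
  -- `min 1 ℓ ≥ ℓ - ℓ² / 4`, so the overlap of the two laws has mass at least `1 / 2`.
  have hpt : ∀ x, ℓ x ≤ min 1 (ℓ x) + 4⁻¹ * ℓ x ^ 2 := by
    intro x
    generalize ℓ x = t
    rcases le_total t 1 with ht | ht
    · rw [min_eq_right ht]; exact le_self_add
    · rw [min_eq_left ht]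
      induction t with
      | top => simp
      | coe t =>
        have h4 : (4⁻¹ : ℝ≥0∞) = ((4⁻¹ : NNReal) : ℝ≥0∞) := by
          rw [ENNReal.coe_inv (by norm_num)]; norm_num
        rw [h4]
        norm_cast
        rw [← NNReal.coe_le_coe]
        push_cast
        nlinarith [sq_nonneg ((t : ℝ) / 2 - 1)]
  have hmin : 2⁻¹ ≤ ∫⁻ x, min 1 (ℓ x) ∂P := by
    have h1 : (1 : ℝ≥0∞) ≤ ∫⁻ x, min 1 (ℓ x) ∂P + 4⁻¹ * 2 := by
      rw [← hone]
      refine (lintegral_mono hpt).trans ?_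
      rw [lintegral_add_left (measurable_const.min hm), lintegral_const_mul _ (hm.pow_const 2)]
      rw [hone]
      gcongr
    have h2 : (4⁻¹ * 2 : ℝ≥0∞) = 2⁻¹ := by
      rw [show (4 : ℝ≥0∞) = 2 * 2 by norm_num, ENNReal.mul_inv (by simp) (by simp), mul_assoc,
        ENNReal.inv_mul_cancel (by simp) (by simp), mul_one]
    rw [h2] at h1
    have h3 : (2⁻¹ : ℝ≥0∞) + 2⁻¹ ≤ ∫⁻ x, min 1 (ℓ x) ∂P + 2⁻¹ := by
      rwa [ENNReal.inv_two_add_inv_two]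
    exact (ENNReal.add_le_add_iff_right (by simp)).1 h3
  have hma : Measurable fun x => ENNReal.ofReal ((f x - a) ^ 2) := by fun_prop
  have hmb : Measurable fun x => ENNReal.ofReal ((f x - b) ^ 2) := by fun_prop
  rw [hd, lintegral_withDensity_eq_lintegral_mul _ hm hmb, ← lintegral_add_left hma]
  calc ENNReal.ofReal ((a - b) ^ 2 / 4)
      = ENNReal.ofReal ((a - b) ^ 2 / 2) * 2⁻¹ := by
        rw [show (2⁻¹ : ℝ≥0∞) = ENNReal.ofReal 2⁻¹ by
          rw [ENNReal.ofReal_inv_of_pos (by norm_num)]; norm_num,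
          ← ENNReal.ofReal_mul (by positivity)]
        congr 1; ring
    _ ≤ ENNReal.ofReal ((a - b) ^ 2 / 2) * ∫⁻ x, min 1 (ℓ x) ∂P := by gcongr
    _ = ∫⁻ x, ENNReal.ofReal ((a - b) ^ 2 / 2) * min 1 (ℓ x) ∂P :=
        (lintegral_const_mul _ (measurable_const.min hm)).symm
    _ ≤ _ := by
        refine lintegral_mono fun x => ?_
        calc ENNReal.ofReal ((a - b) ^ 2 / 2) * min 1 (ℓ x)
            ≤ (ENNReal.ofReal ((f x - a) ^ 2) + ENNReal.ofReal ((f x - b) ^ 2)) * min 1 (ℓ x) := by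
              gcongr
              rw [← ENNReal.ofReal_add (by positivity) (by positivity)]
              apply ENNReal.ofReal_le_ofReal
              nlinarith [sq_nonneg ((f x - a) + (f x - b))]
          _ = min 1 (ℓ x) * ENNReal.ofReal ((f x - a) ^ 2)
                + min 1 (ℓ x) * ENNReal.ofReal ((f x - b) ^ 2) := by ring
          _ ≤ 1 * ENNReal.ofReal ((f x - a) ^ 2) + ℓ x * ENNReal.ofReal ((f x - b) ^ 2) := by
              gcongr
              · exact min_le_left _ _
              · exact min_le_right _ _
          _ = _ := by simp

/-- The second moment of the likelihood ratio of `N(0, v)` to `N(0, 1)` is exactly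
`(1 - (1 - v)²) ^ (-1/2)`: the squared density of `N(0, v)` divided by that of `N(0, 1)` is a
multiple of the density of `N(0, v / (2 - v))`. -/
theorem lrSecondMomentLE_gaussianReal (v : NNReal) (hv : v ≠ 0) (h : (1 - (v : ℝ)) ^ 2 ≤ 1 / 2) :
    LRSecondMomentLE (gaussianReal 0 1) (gaussianReal 0 v)
      (ENNReal.ofReal (Real.exp ((1 - (v : ℝ)) ^ 2))) := by
  have hv0 : 0 < (v : ℝ) := by positivity
  have hv2 : (v : ℝ) < 2 := by nlinarith
  set t : ℝ := (1 - (v : ℝ)) ^ 2 with ht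
  have ht0 : 0 ≤ t := sq_nonneg _
  have hvt : (v : ℝ) * (2 - v) = 1 - t := by rw [ht]; ring
  set w : NNReal := ⟨v / (2 - v), by have : 0 < 2 - (v : ℝ) := by linarith
                                     positivity⟩ with hw
  have hwv : (w : ℝ) = v / (2 - v) := rfl
  have h2v : 0 < 2 - (v : ℝ) := by linarith
  have hw0 : w ≠ 0 := by
    rw [← NNReal.coe_ne_zero, hwv]; positivity
  have hmeas : ∀ u : NNReal, Measurable (gaussianPDFReal 0 u) := measurable_gaussianPDFReal 0
  refine ⟨fun x => ENNReal.ofReal (gaussianPDFReal 0 v x / gaussianPDFReal 0 1 x), ?_, ?_, ?_⟩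
  · have := hmeas v; have := hmeas 1; fun_prop
  · rw [gaussianReal_of_var_ne_zero _ hv, gaussianReal_of_var_ne_zero _ one_ne_zero,
      ← withDensity_mul _ (measurable_gaussianPDF 0 1)
        (by have := hmeas v; have := hmeas 1; fun_prop)]
    congr 1
    ext x
    rw [Pi.mul_apply, gaussianPDF, gaussianPDF,
      ← ENNReal.ofReal_mul (gaussianPDFReal_nonneg _ _ _)]
    congr 1
    have := gaussianPDFReal_pos 0 1 x one_ne_zero
    field_simp
  · rw [gaussianReal_of_var_ne_zero _ one_ne_zero,
      lintegral_withDensity_eq_lintegral_mul _ (measurable_gaussianPDF 0 1)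
        (by have := hmeas v; have := hmeas 1; fun_prop)]
    have key : ∀ x, (gaussianPDF 0 1 * fun x =>
        ENNReal.ofReal (gaussianPDFReal 0 v x / gaussianPDFReal 0 1 x) ^ 2) x
        = ENNReal.ofReal (√(1 - t))⁻¹ * gaussianPDF 0 w x := by
      intro x
      have h1 := gaussianPDFReal_pos 0 1 x one_ne_zero
      have hq := gaussianPDFReal_pos 0 v x hv
      rw [Pi.mul_apply, gaussianPDF, gaussianPDF, ← ENNReal.ofReal_pow (by positivity),
        ← ENNReal.ofReal_mul h1.le, ← ENNReal.ofReal_mul (by positivity)]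
      congr 1
      rw [show gaussianPDFReal 0 1 x * (gaussianPDFReal 0 v x / gaussianPDFReal 0 1 x) ^ 2
        = gaussianPDFReal 0 v x ^ 2 / gaussianPDFReal 0 1 x by field_simp, div_eq_iff h1.ne']
      simp only [gaussianPDFReal, sub_zero, NNReal.coe_one, mul_one, hwv]
      have e : Real.exp (-x ^ 2 / (2 * (v : ℝ))) ^ 2
          = Real.exp (-x ^ 2 / (2 * ((v : ℝ) / (2 - v)))) * Real.exp (-x ^ 2 / 2) := by
        rw [← Real.exp_nat_mul, ← Real.exp_add]
        congr 1
        field_simp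
        push_cast; ring
      have hs : √(2 * Real.pi * v) ^ 2
          = √(1 - t) * √(2 * Real.pi * (v / (2 - v))) * √(2 * Real.pi) := by
        rw [Real.sq_sqrt (by positivity), ← hvt, ← Real.sqrt_mul (by positivity),
          ← Real.sqrt_mul (by positivity)]
        symm
        rw [Real.sqrt_eq_iff_mul_self_eq (by positivity) (by positivity)]
        field_simp
      rw [mul_pow, e, inv_pow, hs, mul_inv, mul_inv]
      ring
    rw [lintegral_congr key, lintegral_const_mul _ (measurable_gaussianPDF 0 w),
      lintegral_gaussianPDF_eq_one 0 hw0, mul_one]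
    apply ENNReal.ofReal_le_ofReal
    refine le_trans ?_ ((by linarith [Real.add_one_le_exp t] : 1 + t ≤ Real.exp t))
    have h1t : 0 < 1 - t := by linarith
    rw [inv_le_comm₀ (by positivity) (by positivity)]
    apply Real.le_sqrt_of_sq_le
    rw [inv_pow, inv_le_iff_one_le_mul₀ (by positivity)]
    nlinarith [mul_nonneg ht0 (sub_nonneg.2 h), mul_nonneg ht0 ht0]

theorem LRSecondMomentLE.pi_gaussianReal {ι : Type*} [Fintype ι] (n : ℕ) (v : ι → NNReal)
    (hv : ∀ i, v i ≠ 0) (h : (n : ℝ) * ∑ i, (1 - (v i : ℝ)) ^ 2 ≤ 1 / 2) (hn : 1 ≤ n) :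
    LRSecondMomentLE (Measure.pi fun _ : Fin n => Measure.pi fun _ : ι => gaussianReal 0 1)
      (Measure.pi fun _ : Fin n => Measure.pi fun i : ι => gaussianReal 0 (v i)) 2 := by
  have hs0 : 0 ≤ ∑ i, (1 - (v i : ℝ)) ^ 2 := Finset.sum_nonneg fun i _ => sq_nonneg _
  have hs : ∑ i, (1 - (v i : ℝ)) ^ 2 ≤ 1 / 2 := by
    have : (1 : ℝ) ≤ n := by exact_mod_cast hn
    nlinarith
  have hi : ∀ i, (1 - (v i : ℝ)) ^ 2 ≤ 1 / 2 := fun i =>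
    (Finset.single_le_sum (f := fun i => (1 - (v i : ℝ)) ^ 2) (fun i _ => sq_nonneg _)
      (Finset.mem_univ i)).trans hs
  refine (LRSecondMomentLE.pi fun _ : Fin n => LRSecondMomentLE.pi fun i : ι =>
    lrSecondMomentLE_gaussianReal (v i) (hv i) (hi i)).mono ?_
  rw [← ENNReal.ofReal_prod_of_nonneg fun i _ => (Real.exp_pos _).le, ← Real.exp_sum,
    Finset.prod_const, Finset.card_univ, Fintype.card_fin, ← ENNReal.ofReal_pow (Real.exp_pos _).le,
    ← Real.exp_nat_mul, show (2 : ℝ≥0∞) = ENNReal.ofReal 2 by simp]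
  apply ENNReal.ofReal_le_ofReal
  calc Real.exp (n * ∑ i, (1 - (v i : ℝ)) ^ 2) ≤ Real.exp (1 / 2) := Real.exp_le_exp.2 h
    _ ≤ 2 := by
      have := Real.exp_one_lt_d9
      have h2 : Real.exp (1 / 2) ^ 2 = Real.exp 1 := by rw [← Real.exp_nat_mul]; norm_num
      nlinarith [Real.exp_pos (1 / 2)]

end SecondMoment

/-! ### Pairs of centred Gaussian laws -/

section GaussianLaw
open Matrix
open scoped MatrixOrder Matrix.Norms.L2Operator

variable {ι : Type*} [Fintype ι] [DecidableEq ι]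

/-- A centred Gaussian law of covariance `M diag(v) Mᵀ` is the image under `M` of a product of
one-dimensional Gaussian laws. -/
theorem multivariateGaussian_eq_map {S M : Matrix ι ι ℝ} (v : ι → NNReal)
    (hS : S = M * diagonal (fun i => (v i : ℝ)) * Mᵀ) :
    multivariateGaussian 0 S = (Measure.pi fun i => gaussianReal 0 (v i)).map
      (fun x => WithLp.toLp 2 (M *ᵥ x)) := by
  have hpsd : S.PosSemidef := by
    rw [hS, ← conjTranspose_eq_transpose_of_trivial]
    exact (PosSemidef.diagonal (fun i => (v i).2)).mul_mul_conjTranspose_same M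
  have hmeas : Measurable fun x : ι → ℝ => WithLp.toLp 2 (M *ᵥ x) := by
    have : Continuous fun x : ι → ℝ => WithLp.toLp 2 (M *ᵥ x) := by fun_prop
    exact this.measurable
  have : IsProbabilityMeasure ((Measure.pi fun i => gaussianReal 0 (v i)).map
      (fun x => WithLp.toLp 2 (M *ᵥ x))) := Measure.isProbabilityMeasure_map hmeas.aemeasurable
  apply Measure.ext_of_charFun
  ext t
  have h1 : charFun ((Measure.pi fun i => gaussianReal 0 (v i)).map
      (fun x => WithLp.toLp 2 (M *ᵥ x))) t
      = charFun ((Measure.pi fun i => gaussianReal 0 (v i)).map (WithLp.toLp 2))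
          (WithLp.toLp 2 (Mᵀ *ᵥ t.ofLp)) := by
    rw [charFun_apply, charFun_apply, integral_map hmeas.aemeasurable (by fun_prop),
      integral_map (by fun_prop) (by fun_prop)]
    congr 1
    ext x
    congr 3
    simp only [EuclideanSpace.inner_eq_star_dotProduct, star_trivial]
    rw [dotProduct_mulVec, mulVec_transpose]
  rw [h1, charFun_multivariateGaussian hpsd, charFun_pi]
  simp_rw [charFun_gaussianReal]
  rw [← Complex.exp_sum]
  congr 1
  have h2 : t.ofLp ⬝ᵥ S *ᵥ t.ofLp = ∑ i, (v i : ℝ) * (Mᵀ *ᵥ t.ofLp) i ^ 2 := by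
    rw [hS, ← mulVec_mulVec, ← mulVec_mulVec, dotProduct_mulVec, ← mulVec_transpose, dotProduct]
    refine Finset.sum_congr rfl fun i _ => ?_
    rw [mulVec_diagonal]; ring
  rw [h2]
  simp [Finset.sum_div]

/-- Two positive definite forms are diagonalized by one matrix `M`: with `S₀ = B Bᵀ` and `U`
orthogonal diagonalizing `B⁻¹ S₁ B⁻ᵀ`, take `M = B U`. -/
theorem exists_simultaneous_diagonalization {S₀ S₁ : Matrix ι ι ℝ} (h₀ : S₀.PosDef)
    (h₁ : S₁.PosDef) :
    ∃ (M : Matrix ι ι ℝ) (v : ι → NNReal), (∀ i, v i ≠ 0) ∧ S₀ = M * Mᵀ ∧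
      S₁ = M * diagonal (fun i => (v i : ℝ)) * Mᵀ ∧
      ∑ i, (1 - (v i : ℝ)) ^ 2 = ((S₀⁻¹ * S₁ - 1) * (S₀⁻¹ * S₁ - 1)).trace := by
  obtain ⟨B, hB, hBS⟩ : ∃ B : Matrix ι ι ℝ, IsUnit B ∧ S₀ = B * Bᵀ := by
    obtain ⟨B, hB, h⟩ := CStarAlgebra.isStrictlyPositive_iff_eq_mul_star_self.1
      (isStrictlyPositive_iff_posDef.2 h₀)
    exact ⟨B, hB, by rw [h, star_eq_conjTranspose, conjTranspose_eq_transpose_of_trivial]⟩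
  have hBd : IsUnit B.det := (isUnit_iff_isUnit_det B).1 hB
  have hT : (B⁻¹ * S₁ * B⁻¹ᵀ).PosDef := by
    rw [← conjTranspose_eq_transpose_of_trivial]
    refine h₁.mul_mul_conjTranspose_same ?_
    rw [vecMul_injective_iff_isUnit]
    exact (isUnit_nonsing_inv_iff).2 hB
  set d := hT.1.eigenvalues with hd
  have hdpos : ∀ i, 0 < d i := hT.eigenvalues_pos
  obtain ⟨U, hU, hUT⟩ : ∃ U : Matrix ι ι ℝ, U * Uᵀ = 1 ∧
      B⁻¹ * S₁ * B⁻¹ᵀ = U * diagonal d * Uᵀ := by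
    refine ⟨hT.1.eigenvectorUnitary, ?_, ?_⟩
    · have := Unitary.coe_mul_star_self hT.1.eigenvectorUnitary
      rwa [Unitary.coe_star, star_eq_conjTranspose, conjTranspose_eq_transpose_of_trivial] at this
    · have := hT.1.spectral_theorem
      rw [Unitary.conjStarAlgAut_apply, star_eq_conjTranspose,
        conjTranspose_eq_transpose_of_trivial] at this
      exact this
  have hBB : B * B⁻¹ = 1 := mul_nonsing_inv B hBd
  have hBB' : B⁻¹ * B = 1 := nonsing_inv_mul B hBd
  have hBBt : B⁻¹ᵀ * Bᵀ = 1 := by rw [← transpose_mul, hBB, transpose_one]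
  have hBBt' : Bᵀ * B⁻¹ᵀ = 1 := by rw [← transpose_mul, hBB', transpose_one]
  have hU' : Uᵀ * U = 1 := mul_eq_one_comm.1 hU
  have hS₁ : S₁ = (B * U) * diagonal d * (B * U)ᵀ := by
    calc S₁ = (B * B⁻¹) * S₁ * (B⁻¹ᵀ * Bᵀ) := by rw [hBB, hBBt, one_mul, mul_one]
      _ = B * (B⁻¹ * S₁ * B⁻¹ᵀ) * Bᵀ := by simp only [Matrix.mul_assoc]
      _ = _ := by rw [hUT, transpose_mul]; simp only [Matrix.mul_assoc]
  have hinv : S₀⁻¹ = B⁻¹ᵀ * B⁻¹ := by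
    apply inv_eq_right_inv
    rw [hBS]
    calc B * Bᵀ * (B⁻¹ᵀ * B⁻¹) = B * (Bᵀ * B⁻¹ᵀ) * B⁻¹ := by simp only [Matrix.mul_assoc]
      _ = 1 := by rw [hBBt', mul_one, hBB]
  have hv : ∀ i, ((d i).toNNReal : ℝ) = d i := fun i => Real.coe_toNNReal _ (hdpos i).le
  refine ⟨B * U, fun i => (d i).toNNReal, fun i => ?_, ?_, by simpa only [hv] using hS₁, ?_⟩
  · exact (Real.toNNReal_pos.2 (hdpos i)).ne'
  · rw [transpose_mul, Matrix.mul_assoc, ← Matrix.mul_assoc U, hU, one_mul, hBS]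
  · -- `S₀⁻¹ S₁ - 1` is conjugate to `diagonal d - 1`.
    have hconj : S₀⁻¹ * S₁ - 1 = B⁻¹ᵀ * U * (diagonal d - 1) * (Uᵀ * Bᵀ) := by
      have e1 : S₀⁻¹ * S₁ = B⁻¹ᵀ * U * diagonal d * (Uᵀ * Bᵀ) := by
        rw [hinv, hS₁, transpose_mul]
        calc B⁻¹ᵀ * B⁻¹ * (B * U * diagonal d * (Uᵀ * Bᵀ))
            = B⁻¹ᵀ * (B⁻¹ * B) * (U * diagonal d * (Uᵀ * Bᵀ)) := by simp only [Matrix.mul_assoc]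
          _ = _ := by rw [hBB', mul_one]; simp only [Matrix.mul_assoc]
      have e2 : B⁻¹ᵀ * U * (Uᵀ * Bᵀ) = 1 := by
        calc B⁻¹ᵀ * U * (Uᵀ * Bᵀ) = B⁻¹ᵀ * (U * Uᵀ) * Bᵀ := by simp only [Matrix.mul_assoc]
          _ = 1 := by rw [hU, mul_one, hBBt]
      rw [e1, mul_sub, sub_mul, mul_one, e2]
    have hW : Uᵀ * Bᵀ * (B⁻¹ᵀ * U) = 1 := by
      calc Uᵀ * Bᵀ * (B⁻¹ᵀ * U) = Uᵀ * (Bᵀ * B⁻¹ᵀ) * U := by simp only [Matrix.mul_assoc]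
        _ = 1 := by rw [hBBt', mul_one, hU']
    have hsq : (S₀⁻¹ * S₁ - 1) * (S₀⁻¹ * S₁ - 1)
        = B⁻¹ᵀ * U * ((diagonal d - 1) * (diagonal d - 1)) * (Uᵀ * Bᵀ) := by
      rw [hconj]
      calc _ = B⁻¹ᵀ * U * (diagonal d - 1) * (Uᵀ * Bᵀ * (B⁻¹ᵀ * U)) * (diagonal d - 1)
            * (Uᵀ * Bᵀ) := by simp only [Matrix.mul_assoc]
        _ = _ := by rw [hW, mul_one]; simp only [Matrix.mul_assoc]
    rw [hsq, trace_mul_comm, ← Matrix.mul_assoc, hW, one_mul, ← diagonal_one, diagonal_sub,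
      diagonal_mul_diagonal, trace_diagonal]
    refine Finset.sum_congr rfl fun i _ => ?_
    rw [hv]
    ring

/-- Two-point bound for samples of size `n` from two centred Gaussian laws with close covariance
matrices. -/
theorem gaussian_sample_two_point {n : ℕ} (hn : 1 ≤ n) {S₀ S₁ : Matrix ι ι ℝ} (h₀ : S₀.PosDef)
    (h₁ : S₁.PosDef) (h : (n : ℝ) * ((S₀⁻¹ * S₁ - 1) * (S₀⁻¹ * S₁ - 1)).trace ≤ 1 / 2)
    {f : (Fin n → EuclideanSpace ℝ ι) → ℝ} (hf : Measurable f) (a b : ℝ) :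
    ENNReal.ofReal ((a - b) ^ 2 / 4) ≤
      ∫⁻ x, ENNReal.ofReal ((f x - a) ^ 2) ∂(Measure.pi fun _ => multivariateGaussian 0 S₀) +
      ∫⁻ x, ENNReal.ofReal ((f x - b) ^ 2) ∂(Measure.pi fun _ => multivariateGaussian 0 S₁) := by
  obtain ⟨M, v, hv, hM₀, hM₁, htr⟩ := exists_simultaneous_diagonalization h₀ h₁
  have hmeas : Measurable fun x : ι → ℝ => WithLp.toLp 2 (M *ᵥ x) := by
    have : Continuous fun x : ι → ℝ => WithLp.toLp 2 (M *ᵥ x) := by fun_prop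
    exact this.measurable
  have e₀ := multivariateGaussian_eq_map (S := S₀) (M := M) (fun _ => 1) (by simpa using hM₀)
  have e₁ := multivariateGaussian_eq_map v hM₁
  have hmap : ∀ w : ι → NNReal,
      (Measure.pi fun _ : Fin n => (Measure.pi fun i => gaussianReal 0 (w i)).map
        fun x => WithLp.toLp 2 (M *ᵥ x)) =
      (Measure.pi fun _ : Fin n => Measure.pi fun i => gaussianReal 0 (w i)).map
        fun x k => WithLp.toLp 2 (M *ᵥ x k) := by
    intro w
    have : IsProbabilityMeasure ((Measure.pi fun i => gaussianReal 0 (w i)).map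
      (fun x => WithLp.toLp 2 (M *ᵥ x))) := Measure.isProbabilityMeasure_map hmeas.aemeasurable
    rw [Measure.pi_map_pi fun _ => hmeas.aemeasurable]
  have hmeas' : Measurable fun (x : Fin n → ι → ℝ) k => WithLp.toLp 2 (M *ᵥ x k) :=
    measurable_pi_lambda _ fun k => hmeas.comp (measurable_pi_apply k)
  rw [e₀, e₁, hmap, hmap, lintegral_map (by fun_prop) hmeas', lintegral_map (by fun_prop) hmeas']
  exact (LRSecondMomentLE.pi_gaussianReal n v hv (by rwa [htr]) hn).two_point
    (hf.comp hmeas') a b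

end GaussianLaw

/-! ### Frobenius norms and inverses -/

section MatrixBounds
open Matrix

variable {ι : Type*} [Fintype ι]

theorem trace_mul_self_le_sum_sq (X : Matrix ι ι ℝ) : (X * X).trace ≤ ∑ i, ∑ j, X i j ^ 2 := by
  have h : (X * X).trace ≤ ∑ i, ∑ j, (X i j ^ 2 + X j i ^ 2) / 2 := by
    simp only [trace, diag_apply, mul_apply]
    gcongr with i _ j _
    nlinarith [sq_nonneg (X i j - X j i)]
  refine h.trans_eq ?_
  simp_rw [← Finset.sum_div, Finset.sum_add_distrib]
  rw [Finset.sum_comm (f := fun i j => X j i ^ 2)]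
  ring

theorem dotProduct_sq_le (x y : ι → ℝ) : (x ⬝ᵥ y) ^ 2 ≤ (x ⬝ᵥ x) * (y ⬝ᵥ y) := by
  have := Finset.sum_mul_sq_le_sq_mul_sq Finset.univ x y
  simpa only [dotProduct, ← sq] using this

/-- If the quadratic form of `A` is at least `δ`, then the Frobenius norm of `E A⁻¹` is at most
that of `E` divided by `δ`. -/
theorem sum_sq_mul_inv_le [DecidableEq ι] {A : Matrix ι ι ℝ} (hA : IsUnit A) {δ : ℝ} (hδ : 0 < δ)
    (h : ∀ y : ι → ℝ, δ * (y ⬝ᵥ y) ≤ y ⬝ᵥ A *ᵥ y) (E : Matrix ι ι ℝ) :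
    ∑ i, ∑ j, (E * A⁻¹) i j ^ 2 ≤ (∑ i, ∑ j, E i j ^ 2) / δ ^ 2 := by
  have hdet : IsUnit A.det := (isUnit_iff_isUnit_det A).1 hA
  rw [Finset.sum_div]
  refine Finset.sum_le_sum fun i _ => ?_
  -- The row `z` of `E A⁻¹` satisfies `z A = E i`, so the hypothesis at `z` involves no inverse.
  set z : ι → ℝ := (E * A⁻¹) i with hz
  have hzA : z ᵥ* A = E i := by
    have : (E * A⁻¹ * A) i = E i := by
      rw [Matrix.mul_assoc, nonsing_inv_mul A hdet, Matrix.mul_one]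
    rw [← this]; rfl
  have h1 : δ * (z ⬝ᵥ z) ≤ E i ⬝ᵥ z := by
    have := h z
    rwa [dotProduct_mulVec, hzA] at this
  have h2 := dotProduct_sq_le (E i) z
  have h0 : 0 ≤ z ⬝ᵥ z := Finset.sum_nonneg fun j _ => mul_self_nonneg _
  have h0' : 0 ≤ E i ⬝ᵥ E i := Finset.sum_nonneg fun j _ => mul_self_nonneg _
  have h3 : δ ^ 2 * (z ⬝ᵥ z) ≤ E i ⬝ᵥ E i := by
    rcases h0.eq_or_lt with h00 | h00
    · rw [← h00, mul_zero]; exact h0'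
    · have : (δ * (z ⬝ᵥ z)) ^ 2 ≤ (E i ⬝ᵥ E i) * (z ⬝ᵥ z) :=
        (pow_le_pow_left₀ (by positivity) h1 2).trans h2
      refine le_of_mul_le_mul_right ?_ h00
      linarith
  rw [le_div_iff₀ (by positivity)]
  simp only [dotProduct, ← sq] at h3
  linarith

/-- If `‖y A‖² ≤ 2 y ⬝ A y`, which for a symmetric `A` says that its spectrum lies in `[0, 2]`,
then `tr (E A⁻¹ E)` is at least half the squared Frobenius norm of the symmetric matrix `E`. -/
theorem trace_mul_inv_mul_ge [DecidableEq ι] {A E : Matrix ι ι ℝ} (hA : IsUnit A) (hE : Eᵀ = E)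
    (h : ∀ y : ι → ℝ, (y ᵥ* A) ⬝ᵥ (y ᵥ* A) ≤ 2 * (y ⬝ᵥ A *ᵥ y)) :
    (∑ i, ∑ j, E i j ^ 2) / 2 ≤ (E * A⁻¹ * E).trace := by
  have hdet : IsUnit A.det := (isUnit_iff_isUnit_det A).1 hA
  rw [Finset.sum_div]
  refine Finset.sum_le_sum fun i _ => ?_
  -- The row `z` of `E A⁻¹` satisfies `z A = E i`, so the hypothesis at `z` involves no inverse.
  set z : ι → ℝ := (E * A⁻¹) i with hz
  have hzA : z ᵥ* A = E i := by
    have : (E * A⁻¹ * A) i = E i := by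
      rw [Matrix.mul_assoc, nonsing_inv_mul A hdet, Matrix.mul_one]
    rw [← this]; rfl
  have h1 := h z
  rw [dotProduct_mulVec, hzA] at h1
  have h2 : (E * A⁻¹ * E).diag i = E i ⬝ᵥ z := by
    rw [diag_apply, mul_apply, dotProduct]
    refine Finset.sum_congr rfl fun j _ => ?_
    rw [mul_comm, ← hz]
    congr 1
    exact congrFun (congrFun hE i) j
  rw [h2]
  have h3 : E i ⬝ᵥ E i = ∑ j, E i j ^ 2 := by simp only [dotProduct, ← sq]
  linarith

end MatrixBounds

/-! ### Block circulant matrices and the loss -/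

section Circulant
open Matrix

variable {p : ℕ}

theorem blockCirc_sub (θ₁ θ₀ : TMat p) : blockCirc (θ₁ - θ₀) = blockCirc θ₁ - blockCirc θ₀ := rfl

theorem blockCirc_transpose {θ : TMat p} (h : θ ∈ Theta p) : (blockCirc θ)ᵀ = blockCirc θ := by
  ext u v
  simp only [transpose_apply, blockCirc, of_apply]
  rw [h.2]; simp

variable [NeZero p]

theorem l1Norm_eq_sum (θ : TMat p) : l1Norm θ = ∑ w : Torus p, |θ w.1 w.2| := by
  rw [Fintype.sum_prod_type]; rfl

theorem l1Norm_nonneg (θ : TMat p) : 0 ≤ l1Norm θ := by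
  rw [l1Norm_eq_sum]; positivity

theorem blockCirc_mulVec (θ : TMat p) (y : Torus p → ℝ) (u : Torus p) :
    (blockCirc θ *ᵥ y) u = ∑ w : Torus p, θ w.1 w.2 * y (u + w) := by
  rw [mulVec, dotProduct]
  refine (Fintype.sum_equiv (Equiv.addLeft u) _ _ fun w => ?_).symm
  simp [blockCirc]

theorem sum_sq_blockCirc (θ : TMat p) :
    ∑ u, ∑ v, blockCirc θ u v ^ 2 = (p : ℝ) ^ 2 * ∑ w : Torus p, θ w.1 w.2 ^ 2 := by
  have : ∀ u : Torus p, ∑ v, blockCirc θ u v ^ 2 = ∑ w : Torus p, θ w.1 w.2 ^ 2 := fun u => by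
    refine (Fintype.sum_equiv (Equiv.addLeft u) _ _ fun w => ?_).symm
    simp [blockCirc]
  rw [Finset.sum_congr rfl fun u _ => this u, Finset.sum_const, Finset.card_univ,
    Fintype.card_prod, ZMod.card, nsmul_eq_mul]
  push_cast; ring

theorem sum_shift_sq (y : Torus p → ℝ) (w : Torus p) : ∑ u, y (u + w) ^ 2 = y ⬝ᵥ y := by
  simp only [dotProduct, ← sq]
  exact Fintype.sum_equiv (Equiv.addRight w) _ _ fun u => rfl

/-- `C(θ)` is a combination of shifts with coefficients `θ[w]`, so its quadratic form is bounded
by the `ℓ¹` norm of `θ`. -/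
theorem dotProduct_blockCirc_mulVec_le (θ : TMat p) (y : Torus p → ℝ) :
    y ⬝ᵥ blockCirc θ *ᵥ y ≤ l1Norm θ * (y ⬝ᵥ y) := by
  have h1 : y ⬝ᵥ blockCirc θ *ᵥ y
      ≤ ∑ u, ∑ w : Torus p, |θ w.1 w.2| * ((y u ^ 2 + y (u + w) ^ 2) / 2) := by
    rw [dotProduct]
    refine Finset.sum_le_sum fun u _ => ?_
    rw [blockCirc_mulVec, Finset.mul_sum]
    refine Finset.sum_le_sum fun w _ => ?_
    have ha : |y u * y (u + w)| ≤ (y u ^ 2 + y (u + w) ^ 2) / 2 := by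
      rw [abs_le]
      constructor <;> nlinarith [sq_nonneg (y u - y (u + w)), sq_nonneg (y u + y (u + w))]
    calc y u * (θ w.1 w.2 * y (u + w)) = θ w.1 w.2 * (y u * y (u + w)) := by ring
      _ ≤ |θ w.1 w.2 * (y u * y (u + w))| := le_abs_self _
      _ = |θ w.1 w.2| * |y u * y (u + w)| := abs_mul _ _
      _ ≤ _ := by gcongr
  refine h1.trans_eq ?_
  rw [Finset.sum_comm, l1Norm_eq_sum, Finset.sum_mul]
  refine Finset.sum_congr rfl fun w _ => ?_
  rw [← Finset.mul_sum, ← Finset.sum_div, Finset.sum_add_distrib, sum_shift_sq]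
  have := sum_shift_sq y 0
  simp only [add_zero] at this
  rw [this]; ring

/-- Young's inequality: the `ℓ²` operator norm of `C(θ)` is at most `‖θ‖₁`. -/
theorem blockCirc_mulVec_sq_le (θ : TMat p) (y : Torus p → ℝ) :
    (blockCirc θ *ᵥ y) ⬝ᵥ (blockCirc θ *ᵥ y) ≤ l1Norm θ ^ 2 * (y ⬝ᵥ y) := by
  have h1 : ∀ u, (blockCirc θ *ᵥ y) u ^ 2
      ≤ l1Norm θ * ∑ w : Torus p, |θ w.1 w.2| * y (u + w) ^ 2 := fun u => by
    rw [blockCirc_mulVec, l1Norm_eq_sum]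
    refine Finset.sum_sq_le_sum_mul_sum_of_sq_le_mul _ (fun w _ => abs_nonneg _)
      (fun w _ => by positivity) fun w _ => ?_
    exact le_of_eq (by rw [mul_pow, ← sq_abs (θ w.1 w.2)]; ring)
  calc (blockCirc θ *ᵥ y) ⬝ᵥ (blockCirc θ *ᵥ y) = ∑ u, (blockCirc θ *ᵥ y) u ^ 2 := by
        simp only [dotProduct, ← sq]
    _ ≤ ∑ u, l1Norm θ * ∑ w : Torus p, |θ w.1 w.2| * y (u + w) ^ 2 :=
        Finset.sum_le_sum fun u _ => h1 u
    _ = l1Norm θ ^ 2 * (y ⬝ᵥ y) := by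
        rw [← Finset.mul_sum, Finset.sum_comm]
        simp_rw [← Finset.mul_sum, sum_shift_sq]
        rw [← Finset.sum_mul, ← l1Norm_eq_sum]; ring

theorem one_sub_blockCirc_coercive (θ : TMat p) (y : Torus p → ℝ) :
    (1 - l1Norm θ) * (y ⬝ᵥ y) ≤ y ⬝ᵥ (1 - blockCirc θ) *ᵥ y := by
  rw [sub_mulVec, one_mulVec, dotProduct_sub]
  linarith [dotProduct_blockCirc_mulVec_le θ y]

theorem one_sub_blockCirc_posDef {θ : TMat p} (h : θ ∈ Theta p) (h1 : l1Norm θ < 1) :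
    (1 - blockCirc θ).PosDef := by
  refine PosDef.of_dotProduct_mulVec_pos ?_ fun y hy => ?_
  · rw [IsHermitian, conjTranspose_eq_transpose_of_trivial, transpose_sub, transpose_one,
      blockCirc_transpose h]
  · rw [star_trivial]
    refine lt_of_lt_of_le ?_ (one_sub_blockCirc_coercive θ y)
    have : 0 < y ⬝ᵥ y := by
      have := dotProduct_star_self_pos_iff (v := y) |>.2 hy
      rwa [star_trivial] at this
    have : 0 < 1 - l1Norm θ := by linarith
    positivity

theorem fieldCov_posDef {σ : ℝ} (hσ : 0 < σ) {θ : TMat p} (h : θ ∈ Theta p) (h1 : l1Norm θ < 1) :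
    (fieldCov σ θ).PosDef :=
  (one_sub_blockCirc_posDef h h1).inv.smul (by positivity)

/-- The loss dominates half the squared `ℓ²` distance, scaled by `σ²`. -/
theorem le_loss {σ : ℝ} {θ₁ θ : TMat p} (h₁ : θ₁ ∈ Theta p) (h : θ ∈ Theta p)
    (hl : l1Norm θ < 1) :
    σ ^ 2 / 2 * ∑ w : Torus p, (θ₁ w.1 w.2 - θ w.1 w.2) ^ 2 ≤ loss σ θ₁ θ := by
  have hE : (blockCirc (θ₁ - θ))ᵀ = blockCirc (θ₁ - θ) := blockCirc_transpose (sub_mem h₁ h)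
  have hA := one_sub_blockCirc_posDef h hl
  have key := trace_mul_inv_mul_ge hA.isUnit hE fun y => by
    have hsymm : y ᵥ* (1 - blockCirc θ) = (1 - blockCirc θ) *ᵥ y := by
      rw [← mulVec_transpose, transpose_sub, transpose_one, blockCirc_transpose h]
    rw [hsymm, sub_mulVec, one_mulVec]
    simp only [sub_dotProduct, dotProduct_sub]
    rw [dotProduct_comm (blockCirc θ *ᵥ y) y]
    have h2 := blockCirc_mulVec_sq_le θ y
    have h3 : 0 ≤ y ⬝ᵥ y := Finset.sum_nonneg fun j _ => mul_self_nonneg _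
    have h4 : l1Norm θ ^ 2 ≤ 1 := pow_le_one₀ (l1Norm_nonneg θ) hl.le
    nlinarith [mul_nonneg h3 (sub_nonneg.2 h4)]
  have hp : (0 : ℝ) < (p : ℝ) ^ 2 := by
    have : (p : ℝ) ≠ 0 := NeZero.ne _
    positivity
  rw [loss, le_div_iff₀ hp, fieldCov, Matrix.mul_smul, Matrix.smul_mul, trace_smul, smul_eq_mul,
    ← blockCirc_sub]
  rw [sum_sq_blockCirc] at key
  simp only [Matrix.sub_apply] at key
  nlinarith [mul_le_mul_of_nonneg_left key (sq_nonneg σ)]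

/-- With `Aᵢ = I - C(θᵢ)`, the matrix `Σ₀⁻¹ Σ₁ - I` equals `C(θ₁ - θ₀) A₁⁻¹`, whose Frobenius
norm is at most that of `C(θ₁ - θ₀)` divided by `1 - ‖θ₁‖₁`. -/
theorem trace_fieldCov_sub_one_sq_le {σ : ℝ} (hσ : 0 < σ) {θ₀ θ₁ : TMat p} (h₀ : θ₀ ∈ Theta p)
    (h₁ : θ₁ ∈ Theta p) (hl₀ : l1Norm θ₀ < 1) (hl₁ : l1Norm θ₁ < 1) :
    (((fieldCov σ θ₀)⁻¹ * fieldCov σ θ₁ - 1) * ((fieldCov σ θ₀)⁻¹ * fieldCov σ θ₁ - 1)).trace ≤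
      (p : ℝ) ^ 2 * (∑ w : Torus p, (θ₁ w.1 w.2 - θ₀ w.1 w.2) ^ 2) / (1 - l1Norm θ₁) ^ 2 := by
  have hA₀ := one_sub_blockCirc_posDef h₀ hl₀
  have hA₁ := one_sub_blockCirc_posDef h₁ hl₁
  have hd₀ := (isUnit_iff_isUnit_det _).1 hA₀.isUnit
  have hd₁ := (isUnit_iff_isUnit_det _).1 hA₁.isUnit
  have hX : (fieldCov σ θ₀)⁻¹ * fieldCov σ θ₁ - 1
      = blockCirc (θ₁ - θ₀) * (1 - blockCirc θ₁)⁻¹ := by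
    have hinv : (fieldCov σ θ₀)⁻¹ = (σ ^ 2)⁻¹ • (1 - blockCirc θ₀) := by
      apply inv_eq_right_inv
      rw [fieldCov, Matrix.smul_mul, Matrix.mul_smul, smul_smul, nonsing_inv_mul _ hd₀,
        mul_inv_cancel₀ (by positivity), one_smul]
    rw [hinv, fieldCov, Matrix.smul_mul, Matrix.mul_smul, smul_smul,
      inv_mul_cancel₀ (by positivity), one_smul]
    have hone := mul_nonsing_inv _ hd₁
    calc (1 - blockCirc θ₀) * (1 - blockCirc θ₁)⁻¹ - 1
        = (1 - blockCirc θ₀) * (1 - blockCirc θ₁)⁻¹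
          - (1 - blockCirc θ₁) * (1 - blockCirc θ₁)⁻¹ := by rw [hone]
      _ = _ := by
        rw [← Matrix.sub_mul, blockCirc_sub, sub_sub_sub_cancel_left]
  rw [hX]
  refine (trace_mul_self_le_sum_sq _).trans ((sum_sq_mul_inv_le hA₁.isUnit (by linarith)
    (one_sub_blockCirc_coercive θ₁) _).trans_eq ?_)
  rw [sum_sq_blockCirc]
  rfl

end Circulant

/-! ### Assouad's lemma over a cube of matrices -/

section Hypercube

variable {p : ℕ}

/-- The vertex of the cube of side `r` based at `θ'` whose coordinates equal to `1` are those of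
the matrices in `T`. -/
noncomputable def cubeVertex (θ' : TMat p) (r : ℝ) (T : Finset (TMat p)) : TMat p :=
  θ' + r • ∑ Ψ ∈ T, Ψ

theorem cubeVertex_mem_Theta {θ' : TMat p} (h : θ' ∈ Theta p) {T : Finset (TMat p)}
    (hT : ∀ Ψ ∈ T, Ψ ∈ Theta p) (r : ℝ) : cubeVertex θ' r T ∈ Theta p :=
  add_mem h (Submodule.smul_mem _ _ (Submodule.sum_mem _ hT))

/-- A vertex of the cube of smaller side `s` lies on the segment from the base point `θ'` to the
vertex of the cube of side `r` with the same coordinates. -/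
theorem cubeVertex_mem_convexHull {B : Set (TMat p)} {T : Finset (TMat p)}
    (hT : (T : Set (TMat p)) ⊆ B) (θ' : TMat p) {r s : ℝ} (hs : 0 ≤ s) (hsr : s ≤ r)
    (hr : 0 < r) : cubeVertex θ' s T ∈ convexHull ℝ (cubeOver B θ' r) := by
  have h0 : θ' ∈ convexHull ℝ (cubeOver B θ' r) :=
    subset_convexHull ℝ _ ⟨∅, by simp, by simp⟩
  have h1 : cubeVertex θ' r T ∈ convexHull ℝ (cubeOver B θ' r) :=
    subset_convexHull ℝ _ ⟨T, hT, rfl⟩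
  have hle : s / r ≤ 1 := (div_le_one hr).2 hsr
  have := (convex_convexHull ℝ (cubeOver B θ' r)) h0 h1 (sub_nonneg.2 hle)
    (div_nonneg hs hr.le) (by ring)
  convert this using 1
  simp only [cubeVertex, smul_add, smul_smul, sub_smul, one_smul]
  rw [div_mul_cancel₀ _ hr.ne']
  abel

theorem cubeVertex_apply (θ' : TMat p) (r : ℝ) (T : Finset (TMat p)) (w : Torus p) :
    cubeVertex θ' r T w.1 w.2 = θ' w.1 w.2 + r * ∑ Ψ ∈ T, Ψ w.1 w.2 := by
  simp [cubeVertex, Matrix.add_apply, Matrix.smul_apply, Matrix.sum_apply]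

theorem cubeVertex_insert_sub [DecidableEq (TMat p)] (θ' : TMat p) (r : ℝ) {T : Finset (TMat p)}
    {Ψ : TMat p} (hΨ : Ψ ∉ T) (w : Torus p) :
    cubeVertex θ' r (insert Ψ T) w.1 w.2 - cubeVertex θ' r T w.1 w.2 = r * Ψ w.1 w.2 := by
  rw [cubeVertex_apply, cubeVertex_apply, Finset.sum_insert hΨ]
  ring

variable [NeZero p]

theorem l1Norm_cubeVertex_le (θ' : TMat p) {r K : ℝ} (hr : 0 ≤ r) {T : Finset (TMat p)}
    (hT : ∀ Ψ ∈ T, l1Norm Ψ ≤ K) : l1Norm (cubeVertex θ' r T) ≤ l1Norm θ' + r * (K * T.card) := by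
  rw [l1Norm_eq_sum, l1Norm_eq_sum]
  have h1 : ∀ w : Torus p, |cubeVertex θ' r T w.1 w.2|
      ≤ |θ' w.1 w.2| + r * ∑ Ψ ∈ T, |Ψ w.1 w.2| := fun w => by
    rw [cubeVertex_apply]
    refine (abs_add_le _ _).trans ?_
    rw [abs_mul, abs_of_nonneg hr]
    gcongr
    exact Finset.abs_sum_le_sum_abs _ _
  refine (Finset.sum_le_sum fun w _ => h1 w).trans ?_
  rw [Finset.sum_add_distrib, ← Finset.mul_sum, Finset.sum_comm]
  gcongr
  calc ∑ Ψ ∈ T, ∑ w : Torus p, |Ψ w.1 w.2| ≤ ∑ _Ψ ∈ T, K :=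
        Finset.sum_le_sum fun Ψ hΨ => by rw [← l1Norm_eq_sum]; exact hT Ψ hΨ
    _ = K * T.card := by rw [Finset.sum_const, nsmul_eq_mul, mul_comm]

/-- The risk dominates the sum of the quadratic risks of the coordinates at distinct nodes. -/
theorem sum_coordinate_risk_le_risk {n : ℕ} {σ : ℝ}
    {est : (Fin n → EuclideanSpace ℝ (Torus p)) → TMat p} (hest : IsEstimator est) {θ : TMat p}
    (hθ : θ ∈ Theta p) (hl : l1Norm θ < 1) {B : Finset (TMat p)} {rep : TMat p → Torus p}
    (hrep : Set.InjOn rep B) :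
    ENNReal.ofReal (σ ^ 2 / 2) * ∑ Ψ ∈ B, ∫⁻ x, ENNReal.ofReal
        ((est x (rep Ψ).1 (rep Ψ).2 - θ (rep Ψ).1 (rep Ψ).2) ^ 2) ∂(sampleLaw n σ θ) ≤
      risk σ est θ := by
  have hmeas : ∀ w : Torus p, Measurable fun x =>
      ENNReal.ofReal ((est x w.1 w.2 - θ w.1 w.2) ^ 2) := fun w =>
    (((hest.2 w.1 w.2).sub_const _).pow_const 2).ennreal_ofReal
  rw [← lintegral_finsetSum _ fun Ψ _ => hmeas (rep Ψ),
    ← lintegral_const_mul _ (Finset.measurable_fun_sum _ fun Ψ _ => hmeas (rep Ψ)), risk]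
  refine lintegral_mono fun x => ?_
  rw [← ENNReal.ofReal_sum_of_nonneg fun _ _ => sq_nonneg _, ← ENNReal.ofReal_mul (by positivity)]
  apply ENNReal.ofReal_le_ofReal
  refine le_trans ?_ (le_loss (hest.1 x) hθ hl)
  classical
  gcongr
  rw [← Finset.sum_image (f := fun w : Torus p => (est x w.1 w.2 - θ w.1 w.2) ^ 2) hrep]
  exact Finset.sum_le_univ_sum_of_nonneg fun w => sq_nonneg _

/-- The combinatorial step of Assouad's lemma: the vertices of a cube are paired along the edges in
each direction `Ψ`, and `2 ^ (d - 1)` edges have a given direction. -/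
theorem sum_powerset_ge {α : Type*} [DecidableEq α] (B : Finset α) (J : Finset α → α → ℝ≥0∞)
    (c : ℝ≥0∞) (h : ∀ Ψ ∈ B, ∀ T ⊆ B, Ψ ∉ T → c ≤ J T Ψ + J (insert Ψ T) Ψ) :
    2 ^ (B.card - 1) * (B.card * c) ≤ ∑ T ∈ B.powerset, ∑ Ψ ∈ B, J T Ψ := by
  rw [Finset.sum_comm]
  calc (2 : ℝ≥0∞) ^ (B.card - 1) * (B.card * c)
      = ∑ _Ψ ∈ B, 2 ^ (B.card - 1) * c := by
        rw [Finset.sum_const, nsmul_eq_mul]; ring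
    _ ≤ _ := Finset.sum_le_sum fun Ψ hΨ => by
        have hB : B.powerset = (insert Ψ (B.erase Ψ)).powerset := by rw [Finset.insert_erase hΨ]
        rw [hB, Finset.sum_powerset_insert (Finset.notMem_erase Ψ B), ← Finset.sum_add_distrib]
        calc (2 : ℝ≥0∞) ^ (B.card - 1) * c = ∑ _T ∈ (B.erase Ψ).powerset, c := by
              rw [Finset.sum_const, Finset.card_powerset, Finset.card_erase_of_mem hΨ,
                nsmul_eq_mul]
              push_cast; rfl
          _ ≤ _ := Finset.sum_le_sum fun T hT => by
              have hT' := Finset.mem_powerset.1 hT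
              exact h Ψ hΨ T (hT'.trans (Finset.erase_subset _ _))
                fun hmem => Finset.notMem_erase Ψ B (hT' hmem)

/-- Assouad's bound over the convex hull of a cube, for matrices `Ψ` separated by the nodes
`rep Ψ`. -/
theorem minimax_cubeOver {n : ℕ} (hn : 1 ≤ n) {σ : ℝ} (hσ : 0 < σ) {B : Finset (TMat p)}
    {rep : TMat p → Torus p}
    (hrep : ∀ Ψ ∈ B, ∀ Φ ∈ B, Φ (rep Ψ).1 (rep Ψ).2 = if Φ = Ψ then 1 else 0)
    (hB : ∀ Ψ ∈ B, Ψ ∈ Theta p) {K : ℝ} (hK : ∀ Ψ ∈ B, l1Norm Ψ ≤ K)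
    (hsq : ∀ Ψ ∈ B, ∑ w : Torus p, Ψ w.1 w.2 ^ 2 ≤ 8) {θ' : TMat p} (hθ' : θ' ∈ Theta p)
    {r : ℝ} (hr : 0 < r) (hl : l1Norm θ' < 1) (hroom : 0 < 1 - l1Norm θ' - K * r * B.card)
    {est : (Fin n → EuclideanSpace ℝ (Torus p)) → TMat p} (hest : IsEstimator est) :
    ENNReal.ofReal (1 / 1024 * min (r ^ 2) ((1 - l1Norm θ') ^ 2 / ((n : ℝ) * (p : ℝ) ^ 2)) *
        (B.card : ℝ) * σ ^ 2) ≤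
      ⨆ θ ∈ convexHull ℝ (cubeOver (B : Set (TMat p)) θ' r), risk σ est θ := by
  classical
  set S := ⨆ θ ∈ convexHull ℝ (cubeOver (B : Set (TMat p)) θ' r), risk σ est θ with hS
  rcases B.eq_empty_or_nonempty with rfl | hne
  · simp
  set δ := 1 - l1Norm θ' with hδ
  have hδ0 : 0 < δ := by linarith
  have hp0 : 0 < (p : ℝ) := by exact_mod_cast Nat.pos_of_ne_zero (NeZero.ne p)
  have hn0 : 0 < (n : ℝ) := by exact_mod_cast hn
  -- Below the scale `x`, neighbouring vertices of the cube give almost the same law.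
  set x := δ / (√n * p) with hx
  have hx0 : 0 < x := by positivity
  have hx2 : x ^ 2 = δ ^ 2 / (n * (p : ℝ) ^ 2) := by
    rw [hx, div_pow, mul_pow, Real.sq_sqrt hn0.le]
  set s := min r x / 8 with hs
  have hs0 : 0 < s := by have := lt_min hr hx0; positivity
  have hsr : s ≤ r / 8 := by rw [hs]; gcongr; exact min_le_left _ _
  have hsx : s ≤ x / 8 := by rw [hs]; gcongr; exact min_le_right _ _
  have hs2 : s ^ 2 = min (r ^ 2) (δ ^ 2 / (n * (p : ℝ) ^ 2)) / 64 := by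
    rw [← hx2, hs, div_pow]
    congr 1
    · rcases le_total r x with h | h
      · rw [min_eq_left h, min_eq_left (by gcongr)]
      · rw [min_eq_right h, min_eq_right (by gcongr)]
    · norm_num
  obtain ⟨Ψ₀, hΨ₀⟩ := hne
  have hK0 : 0 ≤ K := (l1Norm_nonneg Ψ₀).trans (hK Ψ₀ hΨ₀)
  have hΘ : ∀ T ⊆ B, cubeVertex θ' s T ∈ Theta p := fun T hT =>
    cubeVertex_mem_Theta hθ' (fun Ψ h => hB Ψ (hT h)) s
  have hnorm : ∀ T ⊆ B, δ / 2 ≤ 1 - l1Norm (cubeVertex θ' s T) := fun T hT => by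
    have h1 := l1Norm_cubeVertex_le θ' hs0.le (fun Ψ h => hK Ψ (hT h))
    have hcard : (T.card : ℝ) ≤ B.card := by exact_mod_cast Finset.card_le_card hT
    have h2 : s * (K * T.card) ≤ r / 8 * (K * B.card) := by gcongr
    linarith
  have hlt : ∀ T ⊆ B, l1Norm (cubeVertex θ' s T) < 1 := fun T hT => by linarith [hnorm T hT]
  have hinj : Set.InjOn rep B := fun Ψ hΨ Φ hΦ h => by
    by_contra hne
    have h1 := hrep Ψ hΨ Ψ hΨ
    have h2 := hrep Φ hΦ Ψ hΨ
    rw [← h, h1, if_pos rfl, if_neg hne] at h2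
    exact one_ne_zero h2
  -- `J T Ψ` is the risk of the coordinate of direction `Ψ` at the vertex `T`.
  let J : Finset (TMat p) → TMat p → ℝ≥0∞ := fun T Ψ =>
    ∫⁻ y, ENNReal.ofReal ((est y (rep Ψ).1 (rep Ψ).2
      - cubeVertex θ' s T (rep Ψ).1 (rep Ψ).2) ^ 2) ∂(sampleLaw n σ (cubeVertex θ' s T))
  have hJ : ∀ Ψ ∈ B, ∀ T ⊆ B, Ψ ∉ T → ENNReal.ofReal (s ^ 2 / 4) ≤ J T Ψ + J (insert Ψ T) Ψ := by
    intro Ψ hΨ T hT hΨT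
    have hT' : insert Ψ T ⊆ B := Finset.insert_subset hΨ hT
    have htr := trace_fieldCov_sub_one_sq_le hσ (hΘ T hT) (hΘ _ hT') (hlt T hT) (hlt _ hT')
    simp only [cubeVertex_insert_sub θ' s hΨT, mul_pow, ← Finset.mul_sum] at htr
    have hsmall : (n : ℝ) * (((fieldCov σ (cubeVertex θ' s T))⁻¹ *
          fieldCov σ (cubeVertex θ' s (insert Ψ T)) - 1) *
        ((fieldCov σ (cubeVertex θ' s T))⁻¹ *
          fieldCov σ (cubeVertex θ' s (insert Ψ T)) - 1)).trace ≤ 1 / 2 := by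
      calc _ ≤ (n : ℝ) * ((p : ℝ) ^ 2 * (s ^ 2 * 8) / (δ / 2) ^ 2) := by
            refine mul_le_mul_of_nonneg_left (htr.trans ?_) hn0.le
            have := hnorm _ hT'
            have := hsq Ψ hΨ
            gcongr
        _ ≤ (n : ℝ) * ((p : ℝ) ^ 2 * ((x / 8) ^ 2 * 8) / (δ / 2) ^ 2) := by gcongr
        -- The factor `1 / 8` in the definition of `s` is chosen for this equality.
        _ = 1 / 2 := by
            rw [div_pow, hx2]; field_simp; norm_num
    have key := gaussian_sample_two_point hn (fieldCov_posDef hσ (hΘ T hT) (hlt T hT))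
      (fieldCov_posDef hσ (hΘ _ hT') (hlt _ hT')) hsmall (hest.2 (rep Ψ).1 (rep Ψ).2)
      (cubeVertex θ' s T (rep Ψ).1 (rep Ψ).2) (cubeVertex θ' s (insert Ψ T) (rep Ψ).1 (rep Ψ).2)
    refine le_trans (le_of_eq ?_) key
    have hd := cubeVertex_insert_sub θ' s hΨT (rep Ψ)
    rw [hrep Ψ hΨ Ψ hΨ, if_pos rfl, mul_one] at hd
    rw [← neg_sub, hd, neg_sq]
  have hsum := sum_powerset_ge B J _ hJ
  have hrisk : ∀ T ∈ B.powerset, ENNReal.ofReal (σ ^ 2 / 2) * ∑ Ψ ∈ B, J T Ψ ≤ S := by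
    intro T hT
    have hT' := Finset.mem_powerset.1 hT
    refine (sum_coordinate_risk_le_risk hest (hΘ T hT') (hlt T hT') hinj).trans ?_
    exact le_iSup₂ (f := fun θ (_ : θ ∈ convexHull ℝ (cubeOver (B : Set (TMat p)) θ' r)) =>
      risk σ est θ) (cubeVertex θ' s T)
      (cubeVertex_mem_convexHull (Finset.coe_subset.2 hT') θ' hs0.le (by linarith) hr)
  -- The supremum is at least the average over the `2 ^ d` vertices.
  have htotal : ENNReal.ofReal (σ ^ 2 / 2) *
      (2 ^ (B.card - 1) * (B.card * ENNReal.ofReal (s ^ 2 / 4))) ≤ 2 ^ B.card * S := by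
    calc _ ≤ ENNReal.ofReal (σ ^ 2 / 2) * ∑ T ∈ B.powerset, ∑ Ψ ∈ B, J T Ψ := by gcongr
      _ = ∑ T ∈ B.powerset, ENNReal.ofReal (σ ^ 2 / 2) * ∑ Ψ ∈ B, J T Ψ := Finset.mul_sum _ _ _
      _ ≤ ∑ _T ∈ B.powerset, S := Finset.sum_le_sum hrisk
      _ = 2 ^ B.card * S := by
        rw [Finset.sum_const, Finset.card_powerset, nsmul_eq_mul]; push_cast; rfl
  have hcard : B.card = B.card - 1 + 1 := by
    have := Finset.card_pos.2 ⟨Ψ₀, hΨ₀⟩; omega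
  have h2 : ENNReal.ofReal (1 / 1024 * min (r ^ 2) (δ ^ 2 / ((n : ℝ) * (p : ℝ) ^ 2)) *
      (B.card : ℝ) * σ ^ 2) * 2 = ENNReal.ofReal (σ ^ 2 / 2) *
      (B.card * ENNReal.ofReal (s ^ 2 / 4)) := by
    have hL : 1 / 1024 * min (r ^ 2) (δ ^ 2 / ((n : ℝ) * (p : ℝ) ^ 2)) * (B.card : ℝ) * σ ^ 2 * 2 =
        σ ^ 2 / 2 * ((B.card : ℝ) * (s ^ 2 / 4)) := by rw [hs2]; ring
    have h22 : (2 : ℝ≥0∞) = ENNReal.ofReal 2 := by simp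
    rw [h22, ← ENNReal.ofReal_mul' zero_le_two, hL, ENNReal.ofReal_mul (by positivity),
      ENNReal.ofReal_mul (Nat.cast_nonneg _), ENNReal.ofReal_natCast]
  have h3 : (2 : ℝ≥0∞) ^ B.card = 2 ^ (B.card - 1) * 2 := by
    rw [← pow_succ, ← hcard]
  rw [h3, mul_left_comm, mul_assoc, ← h2, ENNReal.mul_le_mul_iff_right
    (pow_ne_zero _ two_ne_zero) (ENNReal.pow_ne_top ENNReal.ofNat_ne_top), mul_comm,
    ENNReal.mul_le_mul_iff_right two_ne_zero ENNReal.ofNat_ne_top] at htotal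
  exact htotal

end Hypercube

/-! ### Indicators of equivalence classes of nodes -/

section Orbits

variable {p : ℕ}

open Classical in
/-- The indicator matrix of the class of the node `u` for the equivalence relation `s`. -/
noncomputable def classInd (s : Setoid (Torus p)) (u : Torus p) : TMat p :=
  Matrix.of fun i j => if s u (i, j) then 1 else 0

open Classical in
theorem classInd_apply (s : Setoid (Torus p)) (u w : Torus p) :
    classInd s u w.1 w.2 = if s u w then 1 else 0 := rfl

theorem classInd_eq_of_rel {s : Setoid (Torus p)} {u v : Torus p} (h : s u v) :
    classInd s u = classInd s v := by
  ext i j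
  have : s u (i, j) ↔ s v (i, j) := ⟨fun h' => s.trans (s.symm h) h', fun h' => s.trans h h'⟩
  classical exact if_congr this rfl rfl

open Classical in
/-- Each class of a node of `m` has a representative `rep Ψ` depending only on its indicator `Ψ`;
at the nodes of that class all other indicators vanish. -/
theorem exists_representatives (s : Setoid (Torus p)) (m : Set (Torus p)) :
    ∃ rep : TMat p → Torus p, (∀ Ψ ∈ classInd s '' m, rep Ψ ∈ m ∧ classInd s (rep Ψ) = Ψ) ∧
      ∀ Ψ ∈ classInd s '' m, ∀ Φ ∈ classInd s '' m, ∀ w, s (rep Ψ) w →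
        Φ w.1 w.2 = if Φ = Ψ then 1 else 0 := by
  classical
  have : ∀ Ψ : TMat p, ∃ u, Ψ ∈ classInd s '' m → u ∈ m ∧ classInd s u = Ψ := fun Ψ => by
    by_cases h : Ψ ∈ classInd s '' m
    · obtain ⟨u, hu⟩ := h
      exact ⟨u, fun _ => hu⟩
    · exact ⟨0, fun h' => absurd h' h⟩
  choose rep hrep using this
  refine ⟨rep, hrep, fun Ψ hΨ Φ hΦ w hw => ?_⟩
  obtain ⟨v, hv, rfl⟩ := hΦ
  have hR : s v w ↔ classInd s v = Ψ := by
    constructor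
    · intro h
      rw [← (hrep Ψ hΨ).2]
      exact classInd_eq_of_rel (s.trans h (s.symm hw))
    · intro h
      have h2 : classInd s v w.1 w.2 = 1 := by
        rw [h, ← (hrep Ψ hΨ).2, classInd_apply, if_pos hw]
      rw [classInd_apply] at h2
      by_contra hc
      rw [if_neg hc] at h2
      exact zero_ne_one h2
  rw [classInd_apply]
  exact if_congr hR rfl rfl

/-- When `m` is a union of classes, the indicators of the classes in `m` form a basis of the space
of matrices supported on `m` and constant on each class. -/
theorem finrank_eq_card_classInd (s : Setoid (Torus p)) {m : Set (Torus p)}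
    (hm : ∀ u v, s u v → u ∈ m → v ∈ m) (V : Submodule ℝ (TMat p))
    (hV : ∀ θ, θ ∈ V ↔ (∀ u v : Torus p, s u v → θ u.1 u.2 = θ v.1 v.2) ∧
      ∀ w : Torus p, w ∉ m → θ w.1 w.2 = 0)
    (B : Finset (TMat p)) (hB : (B : Set (TMat p)) = classInd s '' m) :
    Module.finrank ℝ V = B.card := by
  classical
  obtain ⟨rep, hrep, hone⟩ := exists_representatives s m
  rw [← hB] at hrep hone
  have hspan : Submodule.span ℝ (B : Set (TMat p)) = V := by
    apply le_antisymm
    · rw [Submodule.span_le, hB]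
      rintro _ ⟨u, hu, rfl⟩
      refine (hV _).2 ⟨fun v w hvw => ?_, fun w hw => ?_⟩
      · have : s u v ↔ s u w := ⟨fun h => s.trans h hvw, fun h => s.trans h (s.symm hvw)⟩
        rw [classInd_apply, classInd_apply]
        classical exact if_congr this rfl rfl
      · rw [classInd_apply, if_neg fun h => hw (hm u w h hu)]
    · intro θ hθ
      obtain ⟨hinv, hsupp⟩ := (hV θ).1 hθ
      have : θ = ∑ Ψ ∈ B, θ (rep Ψ).1 (rep Ψ).2 • Ψ := by
        ext i j
        rw [Matrix.sum_apply]
        simp only [Matrix.smul_apply, smul_eq_mul]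
        by_cases hw : (i, j) ∈ m
        · have hmem : classInd s (i, j) ∈ (B : Set (TMat p)) := hB ▸ Set.mem_image_of_mem _ hw
          have hrel : s (rep (classInd s (i, j))) (i, j) := by
            have h2 : classInd s (rep (classInd s (i, j))) i j = 1 := by
              rw [(hrep _ hmem).2]
              exact (classInd_apply s (i, j) (i, j)).trans (if_pos (s.refl _))
            by_contra hc
            have h3 := classInd_apply s (rep (classInd s (i, j))) (i, j)
            rw [if_neg hc] at h3
            exact zero_ne_one (h3.symm.trans h2)
          rw [Finset.sum_eq_single_of_mem (classInd s (i, j)) hmem]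
          · have := hone _ hmem _ hmem _ hrel
            rw [if_pos rfl] at this
            rw [this, mul_one]
            exact (hinv _ _ hrel).symm
          · intro Φ hΦ hne
            have := hone _ hmem Φ hΦ _ hrel
            rw [if_neg hne] at this
            rw [this, mul_zero]
        · rw [hsupp (i, j) hw]
          refine (Finset.sum_eq_zero fun Φ hΦ => ?_).symm
          obtain ⟨u, hu, rfl⟩ : Φ ∈ classInd s '' m := hB ▸ hΦ
          have h3 := classInd_apply s u (i, j)
          rw [if_neg fun h => hw (hm u _ h hu)] at h3
          rw [h3, mul_zero]
      rw [this]
      exact Submodule.sum_mem _ fun Ψ hΨ => Submodule.smul_mem _ _ (Submodule.subset_span hΨ)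
  have hli : LinearIndepOn ℝ id (B : Set (TMat p)) := by
    rw [linearIndepOn_finset_iff]
    intro g hg Ψ hΨ
    have h1 := congrFun (congrFun hg (rep Ψ).1) (rep Ψ).2
    rw [Matrix.sum_apply] at h1
    simp only [id_eq, Matrix.smul_apply, smul_eq_mul, Matrix.zero_apply] at h1
    rw [Finset.sum_eq_single_of_mem Ψ hΨ] at h1
    · rwa [hone Ψ hΨ Ψ hΨ _ (s.refl _), if_pos rfl, mul_one] at h1
    · intro Φ hΦ hne
      rw [hone Ψ hΨ Φ hΦ _ (s.refl _), if_neg hne, mul_zero]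
  rw [← hspan]
  exact finrank_span_finset_eq_card hli

theorem sum_classInd_sq_le [NeZero p] (s : Setoid (Torus p)) (u : Torus p) {F : Finset (Torus p)}
    (hF : ∀ w, s u w → w ∈ F) : ∑ w : Torus p, classInd s u w.1 w.2 ^ 2 ≤ F.card := by
  classical
  simp only [classInd_apply, ite_pow, one_pow, ne_eq, OfNat.ofNat_ne_zero, not_false_eq_true,
    zero_pow, Finset.sum_boole]
  exact_mod_cast Finset.card_le_card fun w hw => hF w (Finset.mem_filter.1 hw).2

theorem l1Norm_classInd [NeZero p] (s : Setoid (Torus p)) (u : Torus p) :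
    l1Norm (classInd s u) = ∑ w : Torus p, classInd s u w.1 w.2 ^ 2 := by
  rw [l1Norm_eq_sum]
  refine Finset.sum_congr rfl fun w _ => ?_
  rw [classInd_apply]
  split_ifs <;> simp

/-- Assouad's bound for the cube generated by the indicators of the classes contained in a model,
for an equivalence relation that identifies `u` and `-u` and has classes of at most `k ≤ 8`
nodes. -/
theorem minimax_classInd [NeZero p] {n : ℕ} (hn : 1 ≤ n) {σ : ℝ} (hσ : 0 < σ)
    (s : Setoid (Torus p)) (hneg : ∀ u, s u (-u)) {m : Set (Torus p)}
    (hm : ∀ u v, s u v → u ∈ m → v ∈ m) (hm0 : (0 : Torus p) ∉ m)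
    {k : ℕ} (hk : k ≤ 8) (hcard : ∀ u, ∃ F : Finset (Torus p), F.card ≤ k ∧ ∀ w, s u w → w ∈ F)
    (V : Submodule ℝ (TMat p))
    (hV : ∀ θ, θ ∈ V ↔ (∀ u v : Torus p, s u v → θ u.1 u.2 = θ v.1 v.2) ∧
      ∀ w : Torus p, w ∉ m → θ w.1 w.2 = 0)
    {θ' : TMat p} {r : ℝ} (hθ' : θ' ∈ V) (hl : l1Norm θ' < 1) (hr : 0 < r)
    (hroom : 0 < 1 - l1Norm θ' - k * r * Module.finrank ℝ V)
    {est : (Fin n → EuclideanSpace ℝ (Torus p)) → TMat p} (hest : IsEstimator est) :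
    ENNReal.ofReal (1 / 1024 * min (r ^ 2) ((1 - l1Norm θ') ^ 2 / ((n : ℝ) * (p : ℝ) ^ 2)) *
        (Module.finrank ℝ V : ℝ) * σ ^ 2) ≤
      ⨆ θ ∈ convexHull ℝ (cubeOver (classInd s '' m) θ' r), risk σ est θ := by
  have hVΘ : ∀ θ ∈ V, θ ∈ Theta p := fun θ hθ =>
    ⟨((hV θ).1 hθ).2 0 hm0, fun i j => ((hV θ).1 hθ).1 (i, j) _ (hneg (i, j))⟩
  have hfin : (classInd s '' m).Finite := (Set.toFinite m).image _
  obtain ⟨B, hB⟩ : ∃ B : Finset (TMat p), (B : Set (TMat p)) = classInd s '' m :=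
    ⟨hfin.toFinset, hfin.coe_toFinset⟩
  have hdim := finrank_eq_card_classInd s hm V hV B hB
  obtain ⟨rep, hrep, hone⟩ := exists_representatives s m
  rw [← hB] at hrep hone ⊢
  rw [hdim] at hroom ⊢
  have hsq : ∀ Ψ ∈ B, ∑ w : Torus p, Ψ w.1 w.2 ^ 2 ≤ k := fun Ψ hΨ => by
    obtain ⟨F, hFc, hF⟩ := hcard (rep Ψ)
    rw [← (hrep Ψ hΨ).2]
    exact (sum_classInd_sq_le s _ hF).trans (by exact_mod_cast hFc)
  refine minimax_cubeOver hn hσ (rep := rep) (fun Ψ hΨ Φ hΦ => ?_) (fun Ψ hΨ => ?_) (K := k)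
    (fun Ψ hΨ => ?_) (fun Ψ hΨ => (hsq Ψ hΨ).trans (by exact_mod_cast hk)) (hVΘ θ' hθ') hr hl
    hroom hest
  · convert hone Ψ hΨ Φ hΦ _ (s.refl _)
  · obtain ⟨u, hu, rfl⟩ : Ψ ∈ classInd s '' m := hB ▸ hΨ
    refine ⟨?_, fun i j => ?_⟩
    · exact (classInd_apply s u 0).trans (if_neg fun h => hm0 (hm u 0 h hu))
    · have h : s u (i, j) ↔ s u (-i, -j) :=
        ⟨fun h => s.trans h (hneg (i, j)), fun h => s.trans h (s.symm (hneg (i, j)))⟩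
      classical exact if_congr h rfl rfl
  · have h1 := hsq Ψ hΨ
    rw [← (hrep Ψ hΨ).2] at h1 ⊢
    rw [l1Norm_classInd]
    exact h1

/-- The equivalence relation identifying `u` and `-u`. -/
def negSetoid (p : ℕ) : Setoid (Torus p) where
  r u w := w = u ∨ w = -u
  iseqv := by
    refine ⟨fun u => Or.inl rfl, ?_, ?_⟩
    · rintro u w (rfl | rfl) <;> simp
    · rintro u v w (rfl | rfl) (rfl | rfl) <;> simp

/-- The equivalence relation whose classes are the orbits `{(±i, ±j), (±j, ±i)}`. -/
def isoSetoid (p : ℕ) : Setoid (Torus p) where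
  r u w := ((w.1 = u.1 ∨ w.1 = -u.1) ∧ (w.2 = u.2 ∨ w.2 = -u.2)) ∨
    ((w.1 = u.2 ∨ w.1 = -u.2) ∧ (w.2 = u.1 ∨ w.2 = -u.1))
  iseqv := by
    refine ⟨fun u => Or.inl ⟨Or.inl rfl, Or.inl rfl⟩, ?_, ?_⟩
    · rintro ⟨a, b⟩ ⟨c, d⟩ h
      dsimp only at h ⊢
      grind
    · rintro ⟨a, b⟩ ⟨c, d⟩ ⟨e, f⟩ h1 h2
      dsimp only at h1 h2 ⊢
      grind

theorem psi_eq_classInd (u : Torus p) : psi u = classInd (negSetoid p) u := by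
  ext i j
  simp only [psi, classInd, Matrix.of_apply]
  congr 1

theorem psiIso_eq_classInd (u : Torus p) : psiIso u = classInd (isoSetoid p) u := by
  ext i j
  simp only [psiIso, classInd, Matrix.of_apply]
  congr 1

theorem zero_notMem_of_mem_modelsM1 {m : Set (Torus p)} (hm : m ∈ modelsM1 p) :
    (0 : Torus p) ∉ m := by
  obtain ⟨ρ, rfl⟩ := hm
  exact fun h => h.1 rfl

theorem valMinAbs_neg_sq (a : ZMod p) : ((-a).valMinAbs : ℝ) ^ 2 = (a.valMinAbs : ℝ) ^ 2 := by
  have h := ZMod.natAbs_valMinAbs_neg a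
  rw [Int.natAbs_eq_iff_sq_eq] at h
  exact_mod_cast h

theorem torusNorm_eq_of_isoSetoid {u v : Torus p} (h : isoSetoid p u v) :
    torusNorm v = torusNorm u := by
  obtain ⟨a, b⟩ := u
  obtain ⟨c, d⟩ := v
  rcases h with ⟨h1 | h1, h2 | h2⟩ | ⟨h1 | h1, h2 | h2⟩ <;> dsimp only at h1 h2 <;> subst h1 h2 <;>
    simp only [torusNorm, valMinAbs_neg_sq, add_comm]

theorem mem_of_isoSetoid {m : Set (Torus p)} (hm : m ∈ modelsM1 p) {u v : Torus p}
    (h : isoSetoid p u v) (hu : u ∈ m) : v ∈ m := by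
  obtain ⟨ρ, rfl⟩ := hm
  refine ⟨fun hv => hu.1 ?_, (torusNorm_eq_of_isoSetoid h).trans_le hu.2⟩
  subst hv
  obtain ⟨a, b⟩ := u
  have key : ∀ x : ZMod p, 0 = x ∨ 0 = -x → x = 0 := by
    rintro x (h | h)
    · exact h.symm
    · exact neg_eq_zero.1 h.symm
  rcases h with ⟨h1, h2⟩ | ⟨h1, h2⟩
  · exact Prod.ext (key _ h1) (key _ h2)
  · exact Prod.ext (key _ h2) (key _ h1)

theorem isoSetoid_of_negSetoid {u v : Torus p} (h : negSetoid p u v) : isoSetoid p u v := by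
  rcases h with rfl | rfl
  · exact (isoSetoid p).refl _
  · exact Or.inl ⟨Or.inr rfl, Or.inr rfl⟩

theorem mem_ThetaM_iff {m : Set (Torus p)} (hm0 : (0 : Torus p) ∉ m) (θ : TMat p) :
    θ ∈ ThetaM m ↔ (∀ u v : Torus p, negSetoid p u v → θ u.1 u.2 = θ v.1 v.2) ∧
      ∀ w : Torus p, w ∉ m → θ w.1 w.2 = 0 := by
  constructor
  · rintro ⟨⟨_, h⟩, hs⟩
    refine ⟨?_, fun w => hs w.1 w.2⟩
    rintro u v (rfl | rfl)
    · rfl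
    · exact h _ _
  · rintro ⟨h, hs⟩
    exact ⟨⟨hs 0 hm0, fun i j => h (i, j) (-i, -j) (Or.inr rfl)⟩, fun i j => hs (i, j)⟩

theorem mem_ThetaMIso_iff {m : Set (Torus p)} (hm0 : (0 : Torus p) ∉ m) (θ : TMat p) :
    θ ∈ ThetaMIso m ↔ (∀ u v : Torus p, isoSetoid p u v → θ u.1 u.2 = θ v.1 v.2) ∧
      ∀ w : Torus p, w ∉ m → θ w.1 w.2 = 0 := by
  constructor
  · rintro ⟨⟨_, h⟩, hs⟩
    refine ⟨?_, fun w => hs w.1 w.2⟩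
    have e1 : ∀ i j, θ (-i) j = θ i j := fun i j => ((h i j).1).symm
    have e2 : ∀ i j, θ i (-j) = θ i j := fun i j => by
      rw [(h i (-j)).2, e1, ← (h i j).2]
    rintro ⟨a, b⟩ ⟨c, d⟩ (⟨h1 | h1, h2 | h2⟩ | ⟨h1 | h1, h2 | h2⟩) <;> dsimp only at h1 h2 ⊢ <;>
      subst h1 h2 <;> (try simp only [e1, e2]) <;> first | rfl | exact (h _ _).2
  · rintro ⟨h, hs⟩
    refine ⟨⟨⟨hs 0 hm0, fun i j => h (i, j) (-i, -j) (Or.inl ⟨Or.inr rfl, Or.inr rfl⟩)⟩,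
      fun i j => ⟨h (i, j) (-i, j) (Or.inl ⟨Or.inr rfl, Or.inl rfl⟩),
        h (i, j) (j, i) (Or.inr ⟨Or.inl rfl, Or.inl rfl⟩)⟩⟩, fun i j => hs (i, j)⟩

theorem card_negSetoid_class (u : Torus p) :
    ∃ F : Finset (Torus p), F.card ≤ 2 ∧ ∀ w, negSetoid p u w → w ∈ F := by
  classical
  refine ⟨{u, -u}, Finset.card_le_two, fun w hw => ?_⟩
  change w = u ∨ w = -u at hw
  simpa using hw

theorem card_isoSetoid_class (u : Torus p) :
    ∃ F : Finset (Torus p), F.card ≤ 8 ∧ ∀ w, isoSetoid p u w → w ∈ F := by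
  classical
  refine ⟨({u.1, -u.1} ×ˢ {u.2, -u.2}) ∪ ({u.2, -u.2} ×ˢ {u.1, -u.1}), ?_, fun w hw => ?_⟩
  · refine (Finset.card_union_le _ _).trans ?_
    rw [Finset.card_product, Finset.card_product]
    have h1 : ({u.1, -u.1} : Finset (ZMod p)).card ≤ 2 := Finset.card_le_two
    have h2 : ({u.2, -u.2} : Finset (ZMod p)).card ≤ 2 := Finset.card_le_two
    nlinarith
  · change (_ ∧ _) ∨ (_ ∧ _) at hw
    simpa using hw

end Orbits

end GMRF

theorem lemma8p5 :
    ∃ L : ℝ, 0 < L ∧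
      ∀ (p : ℕ) [NeZero p] (n : ℕ) (σ : ℝ) (m : Set (GMRF.Torus p)),
        1 ≤ n → 0 < σ → m ∈ GMRF.modelsM1 p →
        (∀ (θ' : GMRF.TMat p) (r : ℝ),
          θ' ∈ GMRF.ThetaM m → GMRF.l1Norm θ' < 1 → 0 < r →
          0 < 1 - GMRF.l1Norm θ' - 2 * r * (GMRF.dimM m : ℝ) →
          ∀ est : (Fin n → EuclideanSpace ℝ (GMRF.Torus p)) → GMRF.TMat p,
            GMRF.IsEstimator est →
            ENNReal.ofReal
                (L * min (r ^ 2) ((1 - GMRF.l1Norm θ') ^ 2 / ((n : ℝ) * (p : ℝ) ^ 2)) *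
                  (GMRF.dimM m : ℝ) * σ ^ 2) ≤
              ⨆ θ ∈ convexHull ℝ (GMRF.hypercube m θ' r), GMRF.risk σ est θ) ∧
        (∀ (θ' : GMRF.TMat p) (r : ℝ),
          θ' ∈ GMRF.ThetaMIso m → GMRF.l1Norm θ' < 1 → 0 < r →
          0 < 1 - GMRF.l1Norm θ' - 8 * r * (GMRF.dimMIso m : ℝ) →
          ∀ est : (Fin n → EuclideanSpace ℝ (GMRF.Torus p)) → GMRF.TMat p,
            GMRF.IsEstimator est →
            ENNReal.ofReal
                (L * min (r ^ 2) ((1 - GMRF.l1Norm θ') ^ 2 / ((n : ℝ) * (p : ℝ) ^ 2)) *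
                  (GMRF.dimMIso m : ℝ) * σ ^ 2) ≤
              ⨆ θ ∈ convexHull ℝ (GMRF.hypercubeIso m θ' r), GMRF.risk σ est θ) := by
  refine ⟨1 / 1024, by norm_num, fun p _ n σ m hn hσ hm => ⟨?_, ?_⟩⟩
  · intro θ' r hθ' hl hr hroom est hest
    have hm0 := GMRF.zero_notMem_of_mem_modelsM1 hm
    rw [GMRF.hypercube, funext GMRF.psi_eq_classInd]
    exact GMRF.minimax_classInd hn hσ (GMRF.negSetoid p) (fun u => Or.inr rfl)
      (fun u v h => GMRF.mem_of_isoSetoid hm (GMRF.isoSetoid_of_negSetoid h)) hm0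
      (k := 2) (by norm_num) GMRF.card_negSetoid_class (GMRF.ThetaM m)
      (GMRF.mem_ThetaM_iff hm0) hθ' hl hr (by exact_mod_cast hroom) hest
  · intro θ' r hθ' hl hr hroom est hest
    have hm0 := GMRF.zero_notMem_of_mem_modelsM1 hm
    rw [GMRF.hypercubeIso, funext GMRF.psiIso_eq_classInd]
    exact GMRF.minimax_classInd hn hσ (GMRF.isoSetoid p)
      (fun u => Or.inl ⟨Or.inr rfl, Or.inr rfl⟩)
      (fun u v h => GMRF.mem_of_isoSetoid hm h) hm0
      (k := 8) le_rfl GMRF.card_isoSetoid_class (GMRF.ThetaMIso m)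
      (GMRF.mem_ThetaMIso_iff hm0) hθ' hl hr (by exact_mod_cast hroom) hest
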